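/- There are a deterministic algorithm and a polynomial $p$ with the following property. Given a finite simple undirected graph $G$ on $n$ vertices in which every vertex has degree at most three (a subcubic graph), and an integer $k \ge 0$, the algorithm decides whether $G$ has a spanning tree with at least $k$ internal vertices, and it takes time at most $3.4854^k \cdot p(n)$; that is, the problem is solved in time $3.4854^k\, n^{\mathcal{O}(1)}$. Here a vertex of a tree is internal if its degree in the tree is at least two. Time is measured as logarithmic cost on a random access machine with addition, truncated subtraction and indirect addressing, which receives $n$, $k$ and the adjacency matrix of $G$ as input. -/

import Mathlib

/-! ## Spanning trees and internal vertices -/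

/-- A graph is subcubic if every vertex has degree at most three. -/
def SimpleGraph.IsSubcubic {V : Type*} (G : SimpleGraph V) : Prop :=
  ∀ v, (G.neighborSet v).encard ≤ 3

/-- The internal (that is, non-leaf) vertices of a tree: those of degree at least two in it. -/
def SimpleGraph.internalVertices {V : Type*} (T : SimpleGraph V) : Set V :=
  {v | 2 ≤ (T.neighborSet v).encard}

/-- `T` is a spanning tree of `G`: a tree on all vertices of `G` that uses only edges of `G`. -/
def SimpleGraph.IsSpanningTree {V : Type*} (G T : SimpleGraph V) : Prop :=
  T ≤ G ∧ T.IsTree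

/-- `G` has a spanning tree with at least `k` internal vertices. -/
def SimpleGraph.HasInternalSpanningTree {V : Type*} (G : SimpleGraph V) (k : ℕ) : Prop :=
  ∃ T : SimpleGraph V, G.IsSpanningTree T ∧ (k : ℕ∞) ≤ T.internalVertices.encard

/-! ## Random access machines with logarithmic cost -/

namespace RAM

/-- The state of the machine: registers, which a program addresses directly, and a memory, which
it addresses indirectly. All cells hold natural numbers. -/
structure State where
  reg : ℕ → ℕ
  mem : ℕ → ℕ

/-- Programs. Only finitely many registers occur in a program. The only arithmetic is addition
and truncated subtraction. -/
inductive Cmd where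
  /-- Do nothing. -/
  | skip : Cmd
  /-- `const d c`: `R[d] := c`. -/
  | const (d c : ℕ) : Cmd
  /-- `add d a b`: `R[d] := R[a] + R[b]`. -/
  | add (d a b : ℕ) : Cmd
  /-- `sub d a b`: `R[d] := R[a] - R[b]`, or `0` if this is negative. -/
  | sub (d a b : ℕ) : Cmd
  /-- `load d a`: `R[d] := M[R[a]]`. -/
  | load (d a : ℕ) : Cmd
  /-- `store a b`: `M[R[a]] := R[b]`. -/
  | store (a b : ℕ) : Cmd
  /-- `seq P Q`: run `P`, then `Q`. -/
  | seq (P Q : Cmd) : Cmd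
  /-- `cond a P Q`: if `R[a] ≠ 0` then run `P`, else run `Q`. -/
  | cond (a : ℕ) (P Q : Cmd) : Cmd
  /-- `loop a P`: while `R[a] ≠ 0`, run `P`. -/
  | loop (a : ℕ) (P : Cmd) : Cmd

/-- `s.setReg d x` is `s` with `x` written to register `d`. -/
def State.setReg (s : State) (d x : ℕ) : State :=
  { s with reg := Function.update s.reg d x }

/-- `s.setMem a x` is `s` with `x` written to memory cell `a`. -/
def State.setMem (s : State) (a x : ℕ) : State :=
  { s with mem := Function.update s.mem a x }

/-- `Exec P s t s'`: started in state `s`, the program `P` halts in state `s'` after time `t`.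
Time is logarithmic cost: each elementary instruction and each test costs one plus the lengths in
binary (`Nat.size`) of the values and of the memory addresses that it handles. -/
inductive Exec : Cmd → State → ℕ → State → Prop
  | skip (s : State) : Exec .skip s 1 s
  | const (d c : ℕ) (s : State) : Exec (.const d c) s (1 + c.size) (s.setReg d c)
  | add (d a b : ℕ) (s : State) :
      Exec (.add d a b) s (1 + (s.reg a).size + (s.reg b).size) (s.setReg d (s.reg a + s.reg b))
  | sub (d a b : ℕ) (s : State) :
      Exec (.sub d a b) s (1 + (s.reg a).size + (s.reg b).size) (s.setReg d (s.reg a - s.reg b))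
  | load (d a : ℕ) (s : State) :
      Exec (.load d a) s (1 + (s.reg a).size + (s.mem (s.reg a)).size)
        (s.setReg d (s.mem (s.reg a)))
  | store (a b : ℕ) (s : State) :
      Exec (.store a b) s (1 + (s.reg a).size + (s.reg b).size) (s.setMem (s.reg a) (s.reg b))
  | seq {P Q : Cmd} {s s' s'' : State} {t t' : ℕ} :
      Exec P s t s' → Exec Q s' t' s'' → Exec (.seq P Q) s (t + t') s''
  | cond_true {a : ℕ} {P : Cmd} (Q : Cmd) {s s' : State} {t : ℕ} :
      s.reg a ≠ 0 → Exec P s t s' → Exec (.cond a P Q) s (1 + (s.reg a).size + t) s'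
  | cond_false {a : ℕ} (P : Cmd) {Q : Cmd} {s s' : State} {t : ℕ} :
      s.reg a = 0 → Exec Q s t s' → Exec (.cond a P Q) s (1 + (s.reg a).size + t) s'
  | loop_true {a : ℕ} {P : Cmd} {s s' s'' : State} {t t' : ℕ} :
      s.reg a ≠ 0 → Exec P s t s' → Exec (.loop a P) s' t' s'' →
        Exec (.loop a P) s (1 + (s.reg a).size + t + t') s''
  | loop_false {a : ℕ} (P : Cmd) {s : State} :
      s.reg a = 0 → Exec (.loop a P) s (1 + (s.reg a).size) s

/-- The machine is deterministic: final state and running time are determined by the program and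
the initial state. -/
theorem Exec.deterministic {P : Cmd} {s s₁ s₂ : State} {t₁ t₂ : ℕ}
    (h₁ : Exec P s t₁ s₁) (h₂ : Exec P s t₂ s₂) : t₁ = t₂ ∧ s₁ = s₂ := by
  induction h₁ generalizing t₂ s₂ with
  | skip | const | add | sub | load | store => cases h₂; exact ⟨rfl, rfl⟩
  | seq _ _ ih ih' =>
    cases h₂ with
    | seq a b =>
      obtain ⟨rfl, rfl⟩ := ih a
      obtain ⟨rfl, rfl⟩ := ih' b
      exact ⟨rfl, rfl⟩
  | cond_true _ h _ ih =>
    cases h₂ with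
    | cond_true _ _ a => obtain ⟨rfl, rfl⟩ := ih a; exact ⟨rfl, rfl⟩
    | cond_false _ h' _ => exact absurd h' h
  | cond_false _ h _ ih =>
    cases h₂ with
    | cond_true _ h' _ => exact absurd h h'
    | cond_false _ _ a => obtain ⟨rfl, rfl⟩ := ih a; exact ⟨rfl, rfl⟩
  | loop_true h _ _ ih ih' =>
    cases h₂ with
    | loop_true _ a b =>
      obtain ⟨rfl, rfl⟩ := ih a
      obtain ⟨rfl, rfl⟩ := ih' b
      exact ⟨rfl, rfl⟩
    | loop_false _ h' => exact absurd h' h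
  | loop_false _ h =>
    cases h₂ with
    | loop_true h' _ _ => exact absurd h h'
    | loop_false _ _ => exact ⟨rfl, rfl⟩

open Classical in
/-- The initial state on input `(G, k)`, for a graph `G` with vertices `0, …, n - 1`: the number
of vertices `n` is in register 0, the parameter `k` in register 1, and the adjacency matrix of `G`,
row by row, is in the memory cells `0, …, n * n - 1`. All other cells hold zero. -/
noncomputable def input {n : ℕ} (G : SimpleGraph (Fin n)) (k : ℕ) : State where
  reg := fun r => if r = 0 then n else if r = 1 then k else 0
  mem := fun a => if ∃ i j : Fin n, a = (i : ℕ) * n + (j : ℕ) ∧ G.Adj i j then 1 else 0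

/-- Started in state `s`, the program `P` halts after time at most `τ`, with the truth value of
`A` (`1` for yes, `0` for no) in register 0. -/
def AnswersInTime (P : Cmd) (s : State) (A : Prop) (τ : ℝ) : Prop :=
  ∃ (t : ℕ) (s' : State), Exec P s t s' ∧ (t : ℝ) ≤ τ ∧
    (A → s'.reg 0 = 1) ∧ (¬ A → s'.reg 0 = 0)

end RAM

/-! Disconnected graphs, n = 0 and k > n are answered with no. For connected G with m edges, a
spanning tree with the most internal vertices, i of them, satisfies m ≤ 2i + 3
(`Connected.exists_isSpanningTree_card_edgeFinset_le`). Unless that tree is a path, two of its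
leaves adjacent in G would permit an improving exchange, so its leaves are independent in G and
double counting applies. Hence m ≥ 2k + 3 forces the answer yes. Otherwise m ≤ 2k + 2, and an
exhaustive search of about 1.8669^m moves is affordable, because 1.8669² < 3.4854.

The search branches on deleting or keeping each edge and refuses deletions that disconnect the
graph. Its leaves are the connected spanning edge sets, among them all spanning trees
(`Valid.search_iff`); up to a factor linear in m they also count the moves. To bound their number,
let F be the deleted set and y = 7/4. Since m - |F| ≥ n - 1, the number is at most y^(m-n+1) · ∑
y^(-|F|), summed over the F that isolate no vertex. That condition is a product of one condition per
vertex, and every edge occurs in exactly two of them. Cauchy–Schwarz, applied edge by edge, bounds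
the sum by the square root of the product of the local sums (1 + 1/y)^d - y^(-d), where d is the
degree. `potential` interpolates between the two sides, `potential_succ` is one application of
Cauchy–Schwarz, and `Valid.moves_le` is the resulting induction. At a vertex of degree 3 the
quantity to be minimised is ((1 + y)^3 - 1) / y^2 = y + 3 + 3/y. Its minimum is at y = √3, which 7/4
approximates, and its value there, about 6.464, is below 1.8669^3.

On the machine all values stay below a bound B that is polynomial in n (plus k when k > n), so
binary lengths are bounded crudely by the values themselves. Every move of the search then takes
polynomial time, and the backtracking needs no stack beyond one flag per edge (`reaches_search`). -/

namespace RAM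

/-! ### Big-step specifications with time bounds -/

/-- Started in `s`, the program `P` halts after time at most `t` in a state satisfying `Q`. -/
def Runs (P : Cmd) (s : State) (t : ℕ) (Q : State → Prop) : Prop :=
  ∃ t' s', Exec P s t' s' ∧ t' ≤ t ∧ Q s'

/-- All registers and memory cells hold values at most `B`. -/
def State.Bdd (s : State) (B : ℕ) : Prop :=
  (∀ r, s.reg r ≤ B) ∧ ∀ a, s.mem a ≤ B

@[simp] theorem State.setReg_reg (s : State) (d x r : ℕ) :
    (s.setReg d x).reg r = if r = d then x else s.reg r := by
  simp [State.setReg, Function.update_apply]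

@[simp] theorem State.setReg_mem (s : State) (d x : ℕ) : (s.setReg d x).mem = s.mem := rfl

@[simp] theorem State.setMem_reg (s : State) (a x : ℕ) : (s.setMem a x).reg = s.reg := rfl

@[simp] theorem State.setMem_mem (s : State) (a x b : ℕ) :
    (s.setMem a x).mem b = if b = a then x else s.mem b := by
  simp [State.setMem, Function.update_apply]

theorem State.Bdd.mono {s : State} {B C : ℕ} (h : s.Bdd B) (hBC : B ≤ C) : s.Bdd C :=
  ⟨fun r => (h.1 r).trans hBC, fun a => (h.2 a).trans hBC⟩

theorem State.Bdd.setReg {s : State} {B d x : ℕ} (h : s.Bdd B) (hx : x ≤ B) :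
    (s.setReg d x).Bdd B := by
  refine ⟨fun r => ?_, h.2⟩
  rw [State.setReg_reg]
  split_ifs
  exacts [hx, h.1 r]

theorem State.Bdd.setMem {s : State} {B a x : ℕ} (h : s.Bdd B) (hx : x ≤ B) :
    (s.setMem a x).Bdd B := by
  refine ⟨h.1, fun b => ?_⟩
  rw [State.setMem_mem]
  split_ifs
  exacts [hx, h.2 b]

theorem size_le_self (m : ℕ) : m.size ≤ m :=
  Nat.size_le.2 Nat.lt_two_pow_self

theorem Runs.mono {P : Cmd} {s : State} {t t' : ℕ} {Q Q' : State → Prop} (h : Runs P s t Q)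
    (ht : t ≤ t') (hQ : ∀ s', Q s' → Q' s') : Runs P s t' Q' := by
  obtain ⟨t₁, s', h₁, h₂, h₃⟩ := h
  exact ⟨t₁, s', h₁, h₂.trans ht, hQ _ h₃⟩

theorem Runs.seq {P P' : Cmd} {s : State} {t t' : ℕ} {Q Q' : State → Prop} (h : Runs P s t Q)
    (h' : ∀ s', Q s' → Runs P' s' t' Q') : Runs (.seq P P') s (t + t') Q' := by
  obtain ⟨t₁, s₁, h₁, h₂, h₃⟩ := h
  obtain ⟨t₂, s₂, h₄, h₅, h₆⟩ := h' _ h₃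
  exact ⟨_, s₂, .seq h₁ h₄, add_le_add h₂ h₅, h₆⟩

theorem Runs.cond {P P' : Cmd} {s : State} {a t B : ℕ} {Q : State → Prop} (hB : s.reg a ≤ B)
    (h : s.reg a ≠ 0 → Runs P s t Q) (h' : s.reg a = 0 → Runs P' s t Q) :
    Runs (.cond a P P') s (1 + B + t) Q := by
  have hs := (size_le_self (s.reg a)).trans hB
  by_cases ha : s.reg a = 0
  · obtain ⟨t₁, s₁, h₁, h₂, h₃⟩ := h' ha
    exact ⟨_, s₁, .cond_false _ ha h₁, by omega, h₃⟩
  · obtain ⟨t₁, s₁, h₁, h₂, h₃⟩ := h ha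
    exact ⟨_, s₁, .cond_true _ ha h₁, by omega, h₃⟩

/-- A loop whose control register counts down. -/
theorem Runs.loop {P : Cmd} {a τ B : ℕ} (I : ℕ → State → Prop)
    (hreg : ∀ i s, I i s → s.reg a = i ∧ i ≤ B)
    (hstep : ∀ i s, I (i + 1) s → Runs P s τ (I i)) :
    ∀ m s, I m s → Runs (.loop a P) s (m * (1 + B + τ) + (1 + B)) (I 0)
  | 0, s, h => by
    have h0 := (hreg 0 s h).1
    exact ⟨_, s, .loop_false _ h0, by simp [h0], h⟩
  | m + 1, s, h => by
    have hm := hreg _ s h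
    obtain ⟨t₁, s₁, h₁, h₂, h₃⟩ := hstep m s h
    obtain ⟨t₂, s₂, h₄, h₅, h₆⟩ := Runs.loop I hreg hstep m s₁ h₃
    have hs := (size_le_self (s.reg a)).trans (hm.1.trans_le hm.2)
    refine ⟨_, s₂, .loop_true (by omega) h₁ h₄, ?_, h₆⟩
    rw [Nat.succ_mul]
    omega

/-! ### Programs without loops -/

/-- The program has no loops. -/
def Cmd.Flat : Cmd → Prop
  | .seq P Q => P.Flat ∧ Q.Flat
  | .cond _ P Q => P.Flat ∧ Q.Flat
  | .loop _ _ => False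
  | _ => True

/-- The effect of a program without loops. -/
def Cmd.eval : Cmd → State → State
  | .skip, s => s
  | .const d c, s => s.setReg d c
  | .add d a b, s => s.setReg d (s.reg a + s.reg b)
  | .sub d a b, s => s.setReg d (s.reg a - s.reg b)
  | .load d a, s => s.setReg d (s.mem (s.reg a))
  | .store a b, s => s.setMem (s.reg a) (s.reg b)
  | .seq P Q, s => Q.eval (P.eval s)
  | .cond a P Q, s => if s.reg a = 0 then Q.eval s else P.eval s
  | .loop _ _, s => s

/-- Growth factor of the values held by the machine during a program without loops. -/
def Cmd.growth : Cmd → ℕ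
  | .const _ c => 1 + c
  | .add _ _ _ => 2
  | .seq P Q => Q.growth * (P.growth + 1)
  | .cond _ P Q => P.growth + Q.growth
  | _ => 1

/-- Cost factor of a program without loops. -/
def Cmd.cost : Cmd → ℕ
  | .const _ c => 1 + c
  | .seq P Q => P.cost + Q.cost * (P.growth + 1)
  | .cond _ P Q => 1 + P.cost + Q.cost
  | _ => 2

/-- A program without loops enlarges values by a factor that depends only on the program, so its
cost is linear in B + 1. Replacing binary lengths by values loses only polynomial factors here. -/
theorem Runs.flat (P : Cmd) : P.Flat → ∀ {s : State} {B : ℕ}, s.Bdd B →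
    Runs P s (P.cost * (B + 1))
      (fun s' => s' = P.eval s ∧ s'.Bdd (P.growth * (B + 1))) := by
  induction P with
  | skip => exact fun _ s B h =>
      ⟨_, _, .skip s, by simp only [Cmd.cost]; omega, rfl,
        h.mono (by simp only [Cmd.growth]; omega)⟩
  | const d c =>
    intro _ s B h
    have hc := size_le_self c
    refine ⟨_, _, .const d c s, by simp only [Cmd.cost]; nlinarith, rfl, ?_⟩
    exact (h.mono (by simp only [Cmd.growth]; nlinarith)).setReg
      (by simp only [Cmd.growth]; nlinarith)
  | add d a b =>
    intro _ s B h
    have ha := (size_le_self (s.reg a)).trans (h.1 a)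
    have hb := (size_le_self (s.reg b)).trans (h.1 b)
    have ha' := h.1 a
    have hb' := h.1 b
    refine ⟨_, _, .add d a b s, by simp only [Cmd.cost]; omega, rfl, ?_⟩
    exact (h.mono (by simp only [Cmd.growth]; omega)).setReg (by simp only [Cmd.growth]; omega)
  | sub d a b =>
    intro _ s B h
    have ha := (size_le_self (s.reg a)).trans (h.1 a)
    have hb := (size_le_self (s.reg b)).trans (h.1 b)
    have ha' := h.1 a
    refine ⟨_, _, .sub d a b s, by simp only [Cmd.cost]; omega, rfl, ?_⟩
    exact (h.mono (by simp only [Cmd.growth]; omega)).setReg (by simp only [Cmd.growth]; omega)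
  | load d a =>
    intro _ s B h
    have ha := (size_le_self (s.reg a)).trans (h.1 a)
    have hb := (size_le_self (s.mem (s.reg a))).trans (h.2 _)
    have hb' := h.2 (s.reg a)
    refine ⟨_, _, .load d a s, by simp only [Cmd.cost]; omega, rfl, ?_⟩
    exact (h.mono (by simp only [Cmd.growth]; omega)).setReg (by simp only [Cmd.growth]; omega)
  | store a b =>
    intro _ s B h
    have ha := (size_le_self (s.reg a)).trans (h.1 a)
    have hb := (size_le_self (s.reg b)).trans (h.1 b)
    have hb' := h.1 b
    refine ⟨_, _, .store a b s, by simp only [Cmd.cost]; omega, rfl, ?_⟩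
    exact (h.mono (by simp only [Cmd.growth]; omega)).setMem (by simp only [Cmd.growth]; omega)
  | seq P Q ihP ihQ =>
    intro hf s B h
    have hB : P.growth * (B + 1) + 1 ≤ (P.growth + 1) * (B + 1) := by nlinarith
    obtain ⟨t₁, s₁, h₁, h₂, rfl, h₃⟩ := ihP hf.1 h
    obtain ⟨t₂, s₂, h₄, h₅, rfl, h₆⟩ := ihQ hf.2 h₃
    refine ⟨_, _, .seq h₁ h₄, ?_, rfl, h₆.mono ?_⟩
    · rw [Cmd.cost, add_mul, mul_assoc]
      exact Nat.add_le_add h₂ (h₅.trans (Nat.mul_le_mul_left _ hB))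
    · simp only [Cmd.growth, mul_assoc]
      exact Nat.mul_le_mul_left _ hB
  | cond a P Q ihP ihQ =>
    intro hf s B h
    refine (Runs.cond (t := P.cost * (B + 1) + Q.cost * (B + 1)) (h.1 a)
      (fun ha => (ihP hf.1 h).mono (Nat.le_add_right _ _) (Q' := fun s' =>
        s' = (Cmd.cond a P Q).eval s ∧ s'.Bdd ((Cmd.cond a P Q).growth * (B + 1)))
          fun s' hs' => ⟨?_, hs'.2.mono ?_⟩)
      (fun ha => (ihQ hf.2 h).mono (Nat.le_add_left _ _) fun s' hs' => ⟨?_, hs'.2.mono ?_⟩)).mono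
        ?_ fun _ => id
    · rw [hs'.1, Cmd.eval, if_neg ha]
    · simp only [Cmd.growth]; nlinarith
    · rw [hs'.1, Cmd.eval, if_pos ha]
    · simp only [Cmd.growth]; nlinarith
    · simp only [Cmd.cost]; nlinarith
  | loop a P => exact fun h => h.elim

end RAM

/-! ### Spanning trees with many internal vertices in subcubic graphs. -/

namespace SimpleGraph

section Exchange

open scoped Classical

variable {V : Type*} [Fintype V]

theorem encard_neighborSet_eq_degree (T : SimpleGraph V) (v : V) :
    (T.neighborSet v).encard = T.degree v := by
  rw [Set.encard_eq_coe_toFinset_card, Set.toFinset_card, card_neighborSet_eq_degree]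

theorem mem_internalVertices_iff {T : SimpleGraph V} {v : V} :
    v ∈ T.internalVertices ↔ 2 ≤ T.degree v := by
  change 2 ≤ (T.neighborSet v).encard ↔ _
  rw [encard_neighborSet_eq_degree]
  exact_mod_cast Iff.rfl

theorem internalVertices_eq (T : SimpleGraph V) :
    T.internalVertices = ((Finset.univ.filter fun v => 2 ≤ T.degree v : Finset V) : Set V) := by
  ext v
  simp [mem_internalVertices_iff]

theorem encard_internalVertices (T : SimpleGraph V) :
    T.internalVertices.encard = (Finset.univ.filter fun v => 2 ≤ T.degree v).card := by
  rw [internalVertices_eq, Set.encard_coe_eq_coe_finsetCard]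

theorem isTree_iff_connected_and_card_edgeFinset {T : SimpleGraph V} :
    T.IsTree ↔ T.Connected ∧ T.edgeFinset.card + 1 = Fintype.card V := by
  rw [isTree_iff_connected_and_card, Nat.card_eq_fintype_card, Nat.card_eq_fintype_card,
    ← edgeFinset_card]

/-- In a connected graph in which some vertex has degree at least three, every cycle passes
through such a vertex. -/
theorem Connected.exists_three_le_degree_of_isCycle {H : SimpleGraph V} (hH : H.Connected)
    {x w : V} {c : H.Walk x x} (hc : c.IsCycle) (hw : 3 ≤ H.degree w) :
    ∃ z ∈ c.support, 3 ≤ H.degree z := by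
  by_contra! hdeg
  -- A vertex of the cycle has two neighbours on it, hence no others if its degree is at most two.
  -- The support is then closed under adjacency and, by connectedness, contains w.
  have hclosed : ∀ a ∈ c.support, ∀ b, H.Adj a b → b ∈ c.support := by
    intro a ha b hab
    have h2 := hc.ncard_neighborSet_toSubgraph_eq_two ha
    have hsub : c.toSubgraph.neighborSet a ⊆ H.neighborSet a :=
      c.toSubgraph.neighborSet_subset a
    have hcard : (H.neighborSet a).ncard ≤ (c.toSubgraph.neighborSet a).ncard := by
      rw [h2, Set.ncard_eq_toFinset_card', Set.toFinset_card, card_neighborSet_eq_degree]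
      have := hdeg a ha
      omega
    have heq := Set.eq_of_subset_of_ncard_le hsub hcard
    have hb : b ∈ c.toSubgraph.neighborSet a := heq ▸ hab
    exact c.mem_verts_toSubgraph.1 (c.toSubgraph.edge_vert (c.toSubgraph.symm.symm _ _ hb))
  have hall : ∀ b, H.Reachable x b → b ∈ c.support := by
    rintro b ⟨p⟩
    suffices ∀ (a b : V) (p : H.Walk a b), a ∈ c.support → b ∈ c.support from
      this x b p c.start_mem_support
    intro a b p
    induction p with
    | nil => exact id
    | cons h _ ih => exact fun ha => ih (hclosed _ ha _ h)
  exact absurd hw (not_le.2 (hdeg w (hall w (hH.preconnected x w))))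

/-- Two adjacent leaves of a spanning tree with a branching vertex allow an exchange that
increases the number of internal vertices. -/
theorem IsSpanningTree.exists_more_internal {G T : SimpleGraph V} (hT : G.IsSpanningTree T)
    {u v w : V} (huv : G.Adj u v) (hu : T.degree u = 1) (hv : T.degree v = 1)
    (hw : 3 ≤ T.degree w) :
    ∃ T', G.IsSpanningTree T' ∧ (Finset.univ.filter fun z => 2 ≤ T.degree z).card <
      (Finset.univ.filter fun z => 2 ≤ T'.degree z).card := by
  -- Two leaves adjacent in T would form a component of their own, which misses w.
  have hnt : ¬ T.Adj u v := by
    intro hadj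
    have hN : ∀ {a b : V}, T.Adj a b → T.degree a = 1 → ∀ z, T.Adj a z → z = b := by
      intro a b hab ha z haz
      rw [← card_neighborFinset_eq_degree, Finset.card_eq_one] at ha
      obtain ⟨y, hy⟩ := ha
      have h1 : b ∈ T.neighborFinset a := by simpa using hab
      have h2 : z ∈ T.neighborFinset a := by simpa using haz
      rw [hy, Finset.mem_singleton] at h1 h2
      rw [h1, h2]
    have key : ∀ (a b : V) (p : T.Walk a b), a = u ∨ a = v → b = u ∨ b = v := by
      intro a b p
      induction p with
      | nil => exact id
      | cons h _ ih =>
        rintro (rfl | rfl)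
        · exact ih (.inr (hN hadj hu _ h))
        · exact ih (.inl (hN hadj.symm hv _ h))
    obtain ⟨p⟩ := hT.2.connected.preconnected u w
    rcases key u w p (.inl rfl) with rfl | rfl <;> omega
  obtain ⟨H, hH⟩ : ∃ H, H = T ⊔ edge u v := ⟨_, rfl⟩
  have hTH : T ≤ H := hH ▸ le_sup_left
  have hHG : H ≤ G := hH ▸ sup_le hT.1 ((edge_le_iff _).2 (.inr huv))
  have hHc : H.Connected := hT.2.connected.mono hTH
  have hHuv : H.Adj u v := by simp [hH, edge_adj, huv.ne]
  have hHadj : ∀ a b, H.Adj a b ↔ T.Adj a b ∨ (a = u ∧ b = v ∨ a = v ∧ b = u) := by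
    intro a b
    have := huv.ne
    simp only [hH, sup_adj, edge_adj]
    grind
  have hdu : H.neighborFinset u = insert v (T.neighborFinset u) := by
    ext z
    have := huv.ne
    simp only [mem_neighborFinset, hHadj, Finset.mem_insert]
    grind
  have hdv : H.neighborFinset v = insert u (T.neighborFinset v) := by
    ext z
    have := huv.ne
    simp only [mem_neighborFinset, hHadj, Finset.mem_insert]
    grind
  have hHu : H.degree u = 2 := by
    rw [← card_neighborFinset_eq_degree, hdu, Finset.card_insert_of_notMem (by simpa using hnt),
      card_neighborFinset_eq_degree, hu]
  have hHv : H.degree v = 2 := by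
    rw [← card_neighborFinset_eq_degree, hdv,
      Finset.card_insert_of_notMem (by simpa using fun h => hnt h.symm),
      card_neighborFinset_eq_degree, hv]
  have hHcard : H.edgeFinset.card = T.edgeFinset.card + 1 := by
    subst hH
    convert card_edgeFinset_sup_edge _ hnt huv.ne
  have hdel : H.deleteEdges {s(u, v)} = T := by
    ext a b
    rw [deleteEdges_adj, hHadj]
    simp only [Set.mem_singleton_iff, Sym2.eq_iff]
    constructor
    · rintro ⟨h | h, h'⟩
      · exact h
      · exact absurd h h'
    · intro h
      refine ⟨.inl h, ?_⟩
      rintro (⟨rfl, rfl⟩ | ⟨rfl, rfl⟩)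
      exacts [hnt h, hnt h.symm]
  obtain ⟨x, c, hc, -⟩ := adj_and_reachable_delete_edges_iff_exists_cycle.1
    (⟨hHuv, by rw [hdel]; exact hT.2.connected.preconnected u v⟩ :
      H.Adj u v ∧ (H.deleteEdges {s(u, v)}).Reachable u v)
  -- The edge to be given up lies on the cycle, so connectedness survives, and it is chosen at a
  -- vertex z of degree at least three, so z stays internal.
  obtain ⟨z, hz, hz3⟩ := hHc.exists_three_le_degree_of_isCycle hc
    (hw.trans (degree_le_of_le hTH))
  have hz2 := hc.ncard_neighborSet_toSubgraph_eq_two hz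
  obtain ⟨z', hz'⟩ : (c.toSubgraph.neighborSet z).Nonempty :=
    Set.nonempty_of_ncard_ne_zero (by omega)
  have hzz' : s(z, z') ∈ c.edges := by
    rw [← Walk.mem_edges_toSubgraph]
    exact hz'
  have hHzz' : H.Adj z z' := c.adj_of_mem_edges hzz'
  have hcon : (H.deleteEdges {s(z, z')}).Connected :=
    hHc.connected_delete_edge_of_not_isBridge fun h => h.notMem_edges_of_isCycle hc hzz'
  obtain ⟨T', hT'⟩ : ∃ T', T' = H.deleteEdges {s(z, z')} := ⟨_, rfl⟩
  rw [← hT'] at hcon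
  have hT'card : T'.edgeFinset.card + 1 = H.edgeFinset.card := by
    have : T'.edgeFinset = H.edgeFinset.erase s(z, z') := by
      ext e
      simp [hT', edgeSet_deleteEdges, and_comm]
    rw [this, Finset.card_erase_of_mem (by simpa using hHzz')]
    have : 0 < H.edgeFinset.card := Finset.card_pos.2 ⟨s(z, z'), by simpa using hHzz'⟩
    omega
  have hTc := (isTree_iff_connected_and_card_edgeFinset.1 hT.2).2
  refine ⟨T', ⟨hT' ▸ (deleteEdges_le _).trans hHG,
    isTree_iff_connected_and_card_edgeFinset.2 ⟨hcon, by omega⟩⟩, ?_⟩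
  have hdeg : ∀ a, a ≠ z' → 2 ≤ H.degree a → 2 ≤ T'.degree a := by
    intro a ha h2
    by_cases haz : a = z
    · subst haz
      have : T'.neighborFinset a = (H.neighborFinset a).erase z' := by
        ext b
        simp only [hT', mem_neighborFinset, deleteEdges_adj, Set.mem_singleton_iff, Sym2.eq_iff,
          Finset.mem_erase]
        grind
      rw [← card_neighborFinset_eq_degree, this, Finset.card_erase_of_mem (by simpa using hHzz'),
        card_neighborFinset_eq_degree]
      omega
    · have : T'.neighborFinset a = H.neighborFinset a := by
        ext b
        simp only [hT', mem_neighborFinset, deleteEdges_adj, Set.mem_singleton_iff, Sym2.eq_iff]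
        grind
      rw [← card_neighborFinset_eq_degree, this, card_neighborFinset_eq_degree]
      exact h2
  set I := Finset.univ.filter fun z => 2 ≤ T.degree z with hI
  -- Adding the edge makes u and v internal, and only z', which may be u or v, can cease to be
  -- internal. The net gain is at least 2 - 1.
  have hsub : (insert u (insert v I)).erase z' ⊆ Finset.univ.filter fun z => 2 ≤ T'.degree z := by
    intro a ha
    simp only [Finset.mem_erase, Finset.mem_insert, hI, Finset.mem_filter, Finset.mem_univ,
      true_and] at ha ⊢
    refine hdeg a ha.1 ?_
    rcases ha.2 with rfl | rfl | h
    · exact hHu.ge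
    · exact hHv.ge
    · exact h.trans (degree_le_of_le hTH)
  have h1 := Finset.card_le_card hsub
  have h2 := Finset.pred_card_le_card_erase (s := insert u (insert v I)) (a := z')
  rw [Finset.card_insert_of_notMem (by simp [hI, hu, huv.ne]),
    Finset.card_insert_of_notMem (by simp [hI, hv])] at h2
  omega

/-- If no two leaves of a spanning tree of a subcubic graph `G` are adjacent in `G`, then `G` has
few edges compared to the number of internal vertices of the tree. -/
theorem IsSpanningTree.card_edgeFinset_le_of_leaves {G T : SimpleGraph V}
    (hT : G.IsSpanningTree T) (hG : ∀ v, G.degree v ≤ 3)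
    (hV : 2 ≤ Fintype.card V)
    (hind : ∀ u v, T.degree u = 1 → T.degree v = 1 → ¬ G.Adj u v) :
    G.edgeFinset.card ≤ 2 * (Finset.univ.filter fun z => 2 ≤ T.degree z).card + 1 := by
  have : Nontrivial V := Fintype.one_lt_card_iff_nontrivial.1 hV
  set I := Finset.univ.filter fun z => 2 ≤ T.degree z with hI
  set L := Finset.univ.filter fun z => ¬ 2 ≤ T.degree z with hL
  have hL1 : ∀ v ∈ L, T.degree v = 1 := by
    intro v hv
    have h1 : 0 < T.degree v := hT.2.connected.preconnected.degree_pos_of_nontrivial v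
    simp only [hL, Finset.mem_filter, Finset.mem_univ, true_and] at hv
    omega
  have hsplit : ∀ f : V → ℕ, ∑ v ∈ I, f v + ∑ v ∈ L, f v = ∑ v, f v := fun f =>
    Finset.sum_filter_add_sum_filter_not _ _ _
  have hcard : I.card + L.card = Fintype.card V := by
    simpa using hsplit fun _ => 1
  have hTsum := sum_degrees_eq_twice_card_edges T
  have hGsum := sum_degrees_eq_twice_card_edges G
  have hTc := (isTree_iff_connected_and_card_edgeFinset.1 hT.2).2
  rw [← hsplit] at hTsum hGsum
  have hTL : ∑ v ∈ L, T.degree v = L.card := by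
    rw [Finset.sum_congr rfl hL1]
    simp
  have hGI : ∑ v ∈ I, G.degree v ≤ I.card * 3 := by
    simpa using Finset.sum_le_card_nsmul I (fun v => G.degree v) 3 fun v _ => hG v
  -- The c non-tree edges between L and I are counted from both sides. Leaves are independent, so
  -- the degrees over L sum to |L| + c. The tree degrees over I sum to 2|I| + |L| - 2, so c ≤ 3|I| -
  -- (2|I| + |L| - 2). Hence 2e ≤ 3|I| + |L| + c ≤ 4|I| + 2.
  let r : V → V → Prop := fun a b => G.Adj a b ∧ ¬ T.Adj a b
  have hr : ∀ v, ((Finset.univ : Finset V).filter (r v)).card + T.degree v = G.degree v := by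
    intro v
    rw [← card_neighborFinset_eq_degree, ← card_neighborFinset_eq_degree,
      ← Finset.card_union_of_disjoint]
    · congr 1
      ext z
      have := @hT.1 v z
      simp only [Finset.mem_union, Finset.mem_filter, Finset.mem_univ, true_and,
        mem_neighborFinset, r]
      tauto
    · rw [Finset.disjoint_left]
      intro z h1 h2
      simp only [Finset.mem_filter, Finset.mem_univ, true_and, mem_neighborFinset, r] at h1 h2
      exact h1.2 h2
  have hcount := Finset.sum_card_bipartiteAbove_eq_sum_card_bipartiteBelow (s := L) (t := I) r
  have hLr : ∀ v ∈ L, (I.bipartiteAbove r v).card + 1 = G.degree v := by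
    intro v hv
    rw [← hr v, hL1 v hv]
    congr 2
    ext z
    simp only [Finset.mem_bipartiteAbove, Finset.mem_filter, Finset.mem_univ, true_and]
    refine ⟨fun h => h.2, fun h => ⟨?_, h⟩⟩
    by_contra hz
    have hzL : z ∈ L := by
      simp only [hI, hL, Finset.mem_filter, Finset.mem_univ, true_and] at hz ⊢
      exact hz
    exact hind v z (hL1 v hv) (hL1 z hzL) h.1
  have hIr : ∀ v ∈ I, (L.bipartiteBelow r v).card + T.degree v ≤ G.degree v := by
    intro v _
    rw [← hr v]
    refine Nat.add_le_add_right (Finset.card_le_card ?_) _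
    intro z hz
    simp only [Finset.mem_bipartiteBelow, Finset.mem_filter, Finset.mem_univ, true_and, r] at hz ⊢
    exact ⟨hz.2.1.symm, fun h => hz.2.2 h.symm⟩
  have h1 := Finset.sum_congr rfl hLr
  have h2 := Finset.sum_le_sum hIr
  rw [Finset.sum_add_distrib] at h1 h2
  simp only [Finset.sum_const, smul_eq_mul, mul_one] at h1
  omega

/-- A connected subcubic graph with `e` edges has a spanning tree with at least `(e - 3) / 2`
internal vertices. -/
theorem Connected.exists_isSpanningTree_card_edgeFinset_le {G : SimpleGraph V}
    (hc : G.Connected) (hG : ∀ v, G.degree v ≤ 3) :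
    ∃ T, G.IsSpanningTree T ∧
      G.edgeFinset.card ≤ 2 * (Finset.univ.filter fun z => 2 ≤ T.degree z).card + 3 := by
  have hne : (Finset.univ.filter fun T => G.IsSpanningTree T).Nonempty := by
    obtain ⟨T, h1, h2⟩ := hc.exists_isTree_le
    exact ⟨T, by simpa using ⟨h1, h2⟩⟩
  obtain ⟨T, hT, hmax⟩ := Finset.exists_max_image _
    (fun T : SimpleGraph V => (Finset.univ.filter fun z => 2 ≤ T.degree z).card) hne
  simp only [Finset.mem_filter, Finset.mem_univ, true_and] at hT hmax
  refine ⟨T, hT, ?_⟩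
  have hGsum := sum_degrees_eq_twice_card_edges G
  have hG3 : ∑ v, G.degree v ≤ Fintype.card V * 3 := by
    simpa using Finset.sum_le_card_nsmul Finset.univ (fun v => G.degree v) 3 fun v _ => hG v
  rcases Nat.lt_or_ge (Fintype.card V) 3 with hV | hV
  · omega
  by_cases hw : ∃ w, 3 ≤ T.degree w
  · obtain ⟨w, hw⟩ := hw
    refine (hT.card_edgeFinset_le_of_leaves hG (by omega) fun u v hu hv huv => ?_).trans (by omega)
    obtain ⟨T', hT', hlt⟩ := hT.exists_more_internal huv hu hv hw
    exact (hmax T' hT').not_gt hlt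
  -- Here T is a path: 2(n - 1) ≤ n + |I| gives |I| ≥ n - 2, and 2e ≤ 3n suffices.
  · push Not at hw
    have hTsum := sum_degrees_eq_twice_card_edges T
    have hTc := (isTree_iff_connected_and_card_edgeFinset.1 hT.2).2
    have hle : ∑ v, T.degree v ≤
        ∑ v, (1 + if 2 ≤ T.degree v then 1 else 0) := by
      refine Finset.sum_le_sum fun v _ => ?_
      have := hw v
      split_ifs <;> omega
    rw [Finset.sum_add_distrib, ← Finset.card_filter] at hle
    simp only [Finset.sum_const, smul_eq_mul, mul_one, Finset.card_univ] at hle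
    omega

end Exchange

end SimpleGraph

/-! ### Graphs given by a list of edges, and the search for a spanning tree -/

namespace EdgeList

open Finset SimpleGraph

variable {n : ℕ}

/-- The edge with index `e` is incident with the vertex `w`. -/
def Inc (u v : ℕ → Fin n) (e : ℕ) (w : Fin n) : Prop := u e = w ∨ v e = w

instance (u v : ℕ → Fin n) (e : ℕ) (w : Fin n) : Decidable (Inc u v e w) :=
  inferInstanceAs (Decidable (_ ∨ _))

/-- The graph whose edges are those with index in `A`. -/
def graph (u v : ℕ → Fin n) (A : Finset ℕ) : SimpleGraph (Fin n) :=
  SimpleGraph.fromEdgeSet ((fun e => s(u e, v e)) '' (A : Set ℕ))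

/-- The first `m` edges are distinct and none of them is a loop. -/
structure Valid (u v : ℕ → Fin n) (m : ℕ) : Prop where
  ne : ∀ e < m, u e ≠ v e
  inj : ∀ e < m, ∀ e' < m, s(u e, v e) = s(u e', v e') → e = e'

/-- The number of vertices of degree at least two. -/
def internal (u v : ℕ → Fin n) (A : Finset ℕ) : ℕ :=
  #{w | 2 ≤ #{e ∈ A | Inc u v e w}}

/-- Search for a spanning tree with `k` internal vertices that contains all edges in `A` except
possibly some of the first `p`. -/
def Search (u v : ℕ → Fin n) (k : ℕ) : ℕ → Finset ℕ → Prop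
  | 0, A => #A + 1 = n ∧ k ≤ internal u v A
  | p + 1, A =>
    ((graph u v (A.erase p)).Connected ∧ Search u v k p (A.erase p)) ∨ Search u v k p A

open Classical in
/-- The number of moves of the search. -/
noncomputable def moves (u v : ℕ → Fin n) : ℕ → Finset ℕ → ℕ
  | 0, _ => 1
  | p + 1, A =>
    -- Three moves per branching: descending, restoring the edge, and ascending. The second is
    -- charged even if the deletion was refused.
    3 + (if (graph u v (A.erase p)).Connected then moves u v p (A.erase p) else 0) + moves u v p A

variable {u v : ℕ → Fin n} {m k p : ℕ} {A : Finset ℕ}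

theorem graph_adj {a b : Fin n} :
    (graph u v A).Adj a b ↔ (∃ e ∈ A, u e = a ∧ v e = b ∨ u e = b ∧ v e = a) ∧ a ≠ b := by
  simp [graph, SimpleGraph.fromEdgeSet_adj]

theorem graph_mono {A' : Finset ℕ} (h : A ⊆ A') : graph u v A ≤ graph u v A' :=
  SimpleGraph.fromEdgeSet_mono (Set.image_mono (by exact_mod_cast h))

theorem Valid.edgeSet_graph (hv : Valid u v m) (hA : A ⊆ range m) :
    (graph u v A).edgeSet = (fun e => s(u e, v e)) '' (A : Set ℕ) := by
  rw [graph, SimpleGraph.edgeSet_fromEdgeSet, sdiff_eq_left, Set.disjoint_left]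
  rintro _ ⟨e, he, rfl⟩ h
  exact hv.ne e (mem_range.1 (hA he)) (by simpa using h)

theorem Valid.injOn (hv : Valid u v m) (hA : A ⊆ range m) :
    Set.InjOn (fun e => s(u e, v e)) (A : Set ℕ) := fun e he e' he' h =>
  hv.inj e (mem_range.1 (hA he)) e' (mem_range.1 (hA he')) h

section

open scoped Classical

theorem Valid.card_edgeFinset (hv : Valid u v m) (hA : A ⊆ range m) :
    (graph u v A).edgeFinset.card = #A := by
  rw [edgeFinset_card, ← Nat.card_eq_fintype_card, hv.edgeSet_graph hA, Nat.card_coe_set_eq,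
    (hv.injOn hA).ncard_image, Set.ncard_coe_finset]

theorem Valid.degree_graph (hv : Valid u v m) (hA : A ⊆ range m) (w : Fin n) :
    (graph u v A).degree w = #{e ∈ A | Inc u v e w} := by
  rw [← card_incidenceSet_eq_degree, ← Nat.card_eq_fintype_card]
  have : (graph u v A).incidenceSet w =
      (fun e => s(u e, v e)) '' ({e ∈ A | Inc u v e w} : Finset ℕ) := by
    ext e
    rw [incidenceSet, hv.edgeSet_graph hA]
    simp only [Set.mem_ofPred_eq, Set.mem_image, mem_coe, mem_filter]
    constructor
    · rintro ⟨⟨i, hi, rfl⟩, hw⟩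
      exact ⟨i, ⟨hi, by simpa [Inc, eq_comm] using hw⟩, rfl⟩
    · rintro ⟨i, ⟨hi, hw⟩, rfl⟩
      exact ⟨⟨i, hi, rfl⟩, by simpa [Inc, eq_comm] using hw⟩
  rw [this, Nat.card_coe_set_eq, 
    ((hv.injOn hA).mono (by exact_mod_cast filter_subset _ _)).ncard_image, Set.ncard_coe_finset]

theorem Valid.encard_internalVertices (hv : Valid u v m) (hA : A ⊆ range m) :
    (graph u v A).internalVertices.encard = internal u v A := by
  rw [SimpleGraph.encard_internalVertices, internal]
  simp only [hv.degree_graph hA]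

theorem Valid.isTree_iff (hv : Valid u v m) (hA : A ⊆ range m) :
    (graph u v A).IsTree ↔ (graph u v A).Connected ∧ #A + 1 = n := by
  rw [isTree_iff_connected_and_card_edgeFinset, hv.card_edgeFinset hA, Fintype.card_fin]

theorem Valid.le_card (hv : Valid u v m) (hA : A ⊆ range m) (hc : (graph u v A).Connected) :
    n ≤ #A + 1 := by
  have := hc.card_vert_le_card_edgeSet_add_one
  rwa [Nat.card_eq_fintype_card, Nat.card_eq_fintype_card, Fintype.card_fin,
    ← edgeFinset_card, hv.card_edgeFinset hA] at this

theorem Valid.exists_inc (hv : Valid u v m) (hA : A ⊆ range m) (hn : 2 ≤ n)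
    (hc : (graph u v A).Connected) (w : Fin n) : ∃ e ∈ A, Inc u v e w := by
  have : Nontrivial (Fin n) := Fin.nontrivial_iff_two_le.2 hn
  have h := hc.preconnected.degree_pos_of_nontrivial w
  rw [hv.degree_graph hA, Finset.card_pos] at h
  obtain ⟨e, he⟩ := h
  exact ⟨e, (mem_filter.1 he).1, (mem_filter.1 he).2⟩

end

/-- Connectedness of A is carried along the recursion, so at the bottom the edge count alone
recognises trees. Pruning loses nothing: a tree that avoids p witnesses that A without p is
connected. -/
theorem Valid.search_iff (hv : Valid u v m) :
    ∀ p A, A ⊆ range m → (graph u v A).Connected →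
      (Search u v k p A ↔ ∃ A' ⊆ A, A \ range p ⊆ A' ∧ (graph u v A').IsTree ∧
        k ≤ internal u v A')
  | 0, A, hA, hc => by
    rw [Search]
    constructor
    · rintro ⟨h1, h2⟩
      exact ⟨A, Subset.rfl, sdiff_subset, (hv.isTree_iff hA).2 ⟨hc, h1⟩, h2⟩
    · rintro ⟨A', h1, h2, h3, h4⟩
      obtain rfl : A' = A := h1.antisymm (by simpa using h2)
      exact ⟨((hv.isTree_iff hA).1 h3).2, h4⟩
  | p + 1, A, hA, hc => by
    have hA' : A.erase p ⊆ range m := (erase_subset _ _).trans hA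
    rw [Search, hv.search_iff p A hA hc]
    constructor
    · rintro (⟨hc', hs⟩ | ⟨A', h1, h2, h3⟩)
      · obtain ⟨A', h1, h2, h3⟩ := (hv.search_iff p _ hA' hc').1 hs
        refine ⟨A', h1.trans (erase_subset _ _), fun e he => h2 ?_, h3⟩
        simp only [mem_sdiff, mem_range, mem_erase] at he ⊢
        exact ⟨⟨by omega, he.1⟩, by omega⟩
      · refine ⟨A', h1, fun e he => h2 ?_, h3⟩
        simp only [mem_sdiff, mem_range] at he ⊢
        exact ⟨he.1, by omega⟩
    · rintro ⟨A', h1, h2, h3⟩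
      by_cases hp : p ∈ A'
      · refine .inr ⟨A', h1, fun e he => ?_, h3⟩
        by_cases hep : e = p
        · exact hep ▸ hp
        · refine h2 ?_
          simp only [mem_sdiff, mem_range] at he ⊢
          exact ⟨he.1, by omega⟩
      · have h1' : A' ⊆ A.erase p := fun e he => mem_erase.2 ⟨fun h => hp (h ▸ he), h1 he⟩
        have hc' := h3.1.connected.mono (graph_mono (u := u) (v := v) h1')
        refine .inl ⟨hc', (hv.search_iff p _ hA' hc').2 ⟨A', h1', fun e he => h2 ?_, h3⟩⟩
        simp only [mem_sdiff, mem_range, mem_erase] at he ⊢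
        exact ⟨he.1.2, by omega⟩

/-- The search finds a spanning tree with `k` internal vertices if there is one. -/
theorem Valid.search_iff_hasInternalSpanningTree (hv : Valid u v m)
    (hc : (graph u v (range m)).Connected) :
    Search u v k m (range m) ↔ (graph u v (range m)).HasInternalSpanningTree k := by
  rw [hv.search_iff m _ Subset.rfl hc]
  constructor
  · rintro ⟨A', h1, -, h2, h3⟩
    refine ⟨graph u v A', ⟨graph_mono h1, h2⟩, ?_⟩
    rw [hv.encard_internalVertices h1]
    exact_mod_cast h3
  · rintro ⟨T, ⟨h1, h2⟩, h3⟩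
    classical
    have hT : graph u v {e ∈ range m | T.Adj (u e) (v e)} = T := by
      ext a b
      rw [graph_adj]
      constructor
      · rintro ⟨⟨e, he, ⟨rfl, rfl⟩ | ⟨rfl, rfl⟩⟩, -⟩
        · exact (mem_filter.1 he).2
        · exact (mem_filter.1 he).2.symm
      · intro hab
        obtain ⟨⟨e, he, h⟩, hne⟩ := graph_adj.1 (h1 hab)
        refine ⟨⟨e, mem_filter.2 ⟨he, ?_⟩, h⟩, hne⟩
        rcases h with ⟨rfl, rfl⟩ | ⟨rfl, rfl⟩
        exacts [hab, hab.symm]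
    refine ⟨{e ∈ range m | T.Adj (u e) (v e)}, filter_subset _ _, by simp, by rwa [hT], ?_⟩
    rw [← hT, hv.encard_internalVertices (filter_subset _ _)] at h3
    exact_mod_cast h3

/-! ### The number of moves of the search -/

/-- The weight of a vertex: the sum of `(4 / 7) ^ #F` over all sets `F` of edges at `w` with index
less than `p` whose removal from `A` does not isolate `w`. -/
noncomputable def weight (u v : ℕ → Fin n) (p : ℕ) (A : Finset ℕ) (w : Fin n) : ℝ :=
  (1 + 4 / 7) ^ #{e ∈ range p | Inc u v e w} -
    if ∃ e ∈ A, p ≤ e ∧ Inc u v e w then 0 else (4 / 7) ^ #{e ∈ range p | Inc u v e w}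

theorem weight_nonneg (w : Fin n) : 0 ≤ weight u v p A w := by
  have : ((4 : ℝ) / 7) ^ #{e ∈ range p | Inc u v e w} ≤
      (1 + 4 / 7) ^ #{e ∈ range p | Inc u v e w} :=
    pow_le_pow_left₀ (by norm_num) (by norm_num) _
  have h0 : (0 : ℝ) ≤ (1 + 4 / 7) ^ #{e ∈ range p | Inc u v e w} := by positivity
  rw [weight]
  split_ifs <;> linarith

theorem weight_succ_of_not_inc {w : Fin n} (h : ¬ Inc u v p w) :
    weight u v (p + 1) A w = weight u v p A w := by
  have h1 : {e ∈ range (p + 1) | Inc u v e w} = {e ∈ range p | Inc u v e w} := by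
    rw [range_add_one, filter_insert, if_neg h]
  have h2 : (∃ e ∈ A, p + 1 ≤ e ∧ Inc u v e w) ↔ ∃ e ∈ A, p ≤ e ∧ Inc u v e w := by
    refine exists_congr fun e => and_congr_right fun _ => and_congr_left fun he => ?_
    have : e ≠ p := fun h' => h (h' ▸ he)
    omega
  simp only [weight, h1, h2]

theorem weight_erase (w : Fin n) :
    (∃ e ∈ A.erase p, p ≤ e ∧ Inc u v e w) ↔ ∃ e ∈ A, p + 1 ≤ e ∧ Inc u v e w := by
  constructor
  · rintro ⟨e, he, h1, h2⟩
    have := ne_of_mem_erase he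
    exact ⟨e, mem_of_mem_erase he, by omega, h2⟩
  · rintro ⟨e, he, h1, h2⟩
    exact ⟨e, mem_erase.2 ⟨by omega, he⟩, by omega, h2⟩

theorem weight_erase_of_not_inc {w : Fin n} (h : ¬ Inc u v p w) :
    weight u v p (A.erase p) w = weight u v p A w := by
  rw [← weight_succ_of_not_inc (A := A) h, weight, weight]
  simp only [weight_erase]
  rw [range_add_one, filter_insert, if_neg h]

/-- The sets F are split by whether they contain p. If p is kept, w can no longer be isolated; if p
is removed, a factor 4/7 comes out. -/
theorem weight_succ_of_inc {w : Fin n} (h : Inc u v p w) (hp : p ∈ A) :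
    weight u v (p + 1) A w = weight u v p A w + 4 / 7 * weight u v p (A.erase p) w := by
  have h1 : #{e ∈ range (p + 1) | Inc u v e w} = #{e ∈ range p | Inc u v e w} + 1 := by
    rw [range_add_one, filter_insert, if_pos h, card_insert_of_notMem (by simp)]
  have h2 : ∃ e ∈ A, p ≤ e ∧ Inc u v e w := ⟨p, hp, le_rfl, h⟩
  simp only [weight, weight_erase, h1, if_pos h2]
  split_ifs <;> ring

/-- Cauchy–Schwarz for the vectors (√a, √(xb)) and (√c, √(xd)), with a common factor √r; a and b
belong to one end of an edge, c and d to the other, and r to the remaining vertices. -/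
theorem sqrt_add_sqrt_le {a b c d x r : ℝ} (ha : 0 ≤ a) (hb : 0 ≤ b) (hc : 0 ≤ c) (hd : 0 ≤ d)
    (hx : 0 ≤ x) (hr : 0 ≤ r) :
    √(a * (c * r)) + x * √(b * (d * r)) ≤ √((a + x * b) * ((c + x * d) * r)) := by
  have h1 : √(a * (c * r)) * √(b * (d * r)) ≤ (a * d * r + b * c * r) / 2 := by
    rw [← Real.sqrt_mul (by positivity), Real.sqrt_le_iff]
    exact ⟨by positivity, by nlinarith [sq_nonneg (a * d * r - b * c * r)]⟩
  have h2 := Real.sq_sqrt (show 0 ≤ a * (c * r) by positivity)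
  have h3 := Real.sq_sqrt (show 0 ≤ b * (d * r) by positivity)
  apply Real.le_sqrt_of_sq_le
  have h4 := mul_le_mul_of_nonneg_left h1 hx
  calc _ = √(a * (c * r)) ^ 2 + 2 * (x * (√(a * (c * r)) * √(b * (d * r)))) +
        x ^ 2 * √(b * (d * r)) ^ 2 := by ring
    _ ≤ _ := by rw [h2, h3]; nlinarith

/-- The potential of a state of the search. -/
noncomputable def potential (u v : ℕ → Fin n) (p : ℕ) (A : Finset ℕ) : ℝ :=
  (7 / 4) ^ #A * √(∏ w, weight u v p A w)

theorem potential_nonneg : 0 ≤ potential u v p A := by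
  unfold potential; positivity

/-- The edge p enters exactly two vertex weights. Deleting it lowers (7/4)^#A by the factor 7/4,
which supplies the coefficient 4/7 that the expansion of both weights requires. -/
theorem potential_succ (huv : u p ≠ v p) (hp : p ∈ A) :
    potential u v p (A.erase p) + potential u v p A ≤ potential u v (p + 1) A := by
  have hprod : ∀ f : Fin n → ℝ, ∏ w, f w =
      f (u p) * (f (v p) * ∏ w ∈ (univ.erase (u p)).erase (v p), f w) := by
    intro f
    rw [mul_prod_erase _ _ (mem_erase.2 ⟨huv.symm, mem_univ _⟩), mul_prod_erase _ _ (mem_univ _)]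
  have hrest : ∀ w ∈ (univ.erase (u p)).erase (v p), ¬ Inc u v p w := by
    rintro w hw (rfl | rfl) <;> simp at hw
  have hr : 0 ≤ ∏ w ∈ (univ.erase (u p)).erase (v p), weight u v p A w :=
    prod_nonneg fun w _ => weight_nonneg w
  have hcard : (7 / 4 : ℝ) ^ #A = (7 / 4) ^ #(A.erase p) * (7 / 4) := by
    rw [← pow_succ, card_erase_add_one hp]
  simp only [potential, hprod]
  rw [prod_congr rfl fun w hw => weight_erase_of_not_inc (hrest w hw),
    prod_congr rfl fun w hw => weight_succ_of_not_inc (A := A) (hrest w hw),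
    weight_succ_of_inc (.inl rfl) hp, weight_succ_of_inc (.inr rfl) hp]
  have key := sqrt_add_sqrt_le (weight_nonneg (u := u) (v := v) (p := p) (A := A) (u p))
    (weight_nonneg (u := u) (v := v) (p := p) (A := A.erase p) (u p))
    (weight_nonneg (u := u) (v := v) (p := p) (A := A) (v p))
    (weight_nonneg (u := u) (v := v) (p := p) (A := A.erase p) (v p))
    (show (0 : ℝ) ≤ 4 / 7 by norm_num) hr
  refine le_trans (le_of_eq ?_) (mul_le_mul_of_nonneg_left key (by positivity))
  rw [hcard]
  ring

-- At p = 0 all weights are 1, since a connected graph on at least two vertices isolates none of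
-- them, and #A ≥ n - 1. In the induction step the first conjunct pays for the three moves of the
-- node, which turns 3p + 1 into 3(p + 1) + 1.
open Classical in
theorem Valid.moves_le (hv : Valid u v m) (hn : 2 ≤ n) :
    ∀ p A, p ≤ m → A ⊆ range m → range p ⊆ A → (graph u v A).Connected →
      (7 / 4 : ℝ) ^ (n - 1) ≤ potential u v p A ∧
      (7 / 4 : ℝ) ^ (n - 1) * moves u v p A ≤ (3 * p + 1) * potential u v p A
  | 0, A, _, hA, _, hc => by
    have hw : ∀ w, weight u v 0 A w = 1 := by
      intro w
      obtain ⟨e, he, hew⟩ := hv.exists_inc hA hn hc w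
      rw [weight, if_pos ⟨e, he, Nat.zero_le _, hew⟩]
      simp
    have h1 := hv.le_card hA hc
    have h2 : (7 / 4 : ℝ) ^ (n - 1) ≤ (7 / 4) ^ #A :=
      pow_le_pow_right₀ (by norm_num) (by omega)
    simpa [potential, hw, moves] using h2
  | p + 1, A, hp, hA, hpA, hc => by
    have hpm : p ∈ A := hpA (by simp)
    have hsub : range p ⊆ A := (range_subset_range.2 (Nat.le_succ p)).trans hpA
    obtain ⟨h1, h2⟩ := hv.moves_le hn p A (by omega) hA hsub hc
    have h3 := potential_succ (hv.ne p (by omega)) hpm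
    have h4 : (7 / 4 : ℝ) ^ (n - 1) *
        (if (graph u v (A.erase p)).Connected then moves u v p (A.erase p) else 0 : ℕ) ≤
          (3 * p + 1) * potential u v p (A.erase p) := by
      split_ifs with h
      · refine (hv.moves_le hn p _ (by omega) ((erase_subset _ _).trans hA) ?_ h).2
        intro e he
        have := mem_range.1 he
        exact mem_erase.2 ⟨by omega, hsub he⟩
      · have := potential_nonneg (u := u) (v := v) (p := p) (A := A.erase p)
        simp only [Nat.cast_zero, mul_zero]
        positivity
    have h5 := potential_nonneg (u := u) (v := v) (p := p) (A := A.erase p)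
    refine ⟨by linarith, ?_⟩
    have h6 : (3 * (p : ℝ) + 1) * (potential u v p (A.erase p) + potential u v p A) ≤
        (3 * p + 1) * potential u v (p + 1) A := mul_le_mul_of_nonneg_left h3 (by positivity)
    rw [moves]
    rw [Nat.cast_add, Nat.cast_add, mul_add, mul_add]
    push_cast at h4 ⊢
    linarith

end EdgeList

/-! ### The size of the search on a connected subcubic graph. -/

namespace EdgeList

open Finset SimpleGraph

variable {n m k : ℕ} {u v : ℕ → Fin n}

theorem Valid.sum_card_inc (hv : Valid u v m) :
    ∑ w, #{e ∈ range m | Inc u v e w} = 2 * m := by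
  classical
  have h := sum_degrees_eq_twice_card_edges (graph u v (range m))
  simpa only [hv.degree_graph Subset.rfl, hv.card_edgeFinset Subset.rfl, card_range] using h

/-- After squaring, both sides are products over the vertices, because the degrees sum to 2m.
Connectedness leaves the degrees 1, 2 and 3. The tightest is 3, where (11/4)^3 - 1 ≈ 19.80 is
compared with (7/4)^2 · 1.8669^3 ≈ 19.93. -/
theorem Valid.potential_le (hv : Valid u v m) (hn : 2 ≤ n)
    (hc : (graph u v (range m)).Connected) (hdeg : ∀ w, #{e ∈ range m | Inc u v e w} ≤ 3) :
    potential u v m (range m) ≤ (7 / 4) ^ n * 1.8669 ^ m := by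
  have hw : ∀ w, (7 / 4) ^ #{e ∈ range m | Inc u v e w} * weight u v m (range m) w ≤
      (7 / 4) ^ 2 * 1.8669 ^ #{e ∈ range m | Inc u v e w} := by
    intro w
    obtain ⟨e, he, hew⟩ := hv.exists_inc Subset.rfl hn hc w
    have h0 : 0 < #{e ∈ range m | Inc u v e w} := card_pos.2 ⟨e, mem_filter.2 ⟨he, hew⟩⟩
    have hnot : ¬ ∃ e ∈ range m, m ≤ e ∧ Inc u v e w := by
      rintro ⟨e, he, h, -⟩
      exact absurd (mem_range.1 he) (by omega)
    rw [weight, if_neg hnot]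
    have h3 := hdeg w
    generalize #{e ∈ range m | Inc u v e w} = d at h0 h3
    interval_cases d <;> norm_num
  have hprod := prod_le_prod (s := univ)
    (fun w _ => mul_nonneg (by positivity) (weight_nonneg w)) fun w _ => hw w
  rw [prod_mul_distrib, prod_mul_distrib, prod_pow_eq_pow_sum, prod_pow_eq_pow_sum,
    prod_pow_eq_pow_sum, hv.sum_card_inc] at hprod
  simp only [sum_const, card_univ, Fintype.card_fin, smul_eq_mul] at hprod
  refine abs_le_of_sq_le_sq' ?_ (by positivity) |>.2
  rw [potential, mul_pow, Real.sq_sqrt (prod_nonneg fun w _ => weight_nonneg w), card_range]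
  calc _ = (7 / 4 : ℝ) ^ (2 * m) * ∏ w, weight u v m (range m) w := by ring
    _ ≤ _ := hprod
    _ = _ := by ring

/-- From m ≤ 2k + 2 and 1.8669² < 3.4854 one gets 1.8669^m ≤ 4 · 3.4854^k. The constant 7 is this 4
times the 7/4 left over from (7/4)^n against (7/4)^(n-1). A single vertex is separate because
`Valid.moves_le` needs every vertex to have an edge. -/
theorem Valid.moves_root_le (hv : Valid u v m) (hn : n ≠ 0)
    (hc : (graph u v (range m)).Connected) (hdeg : ∀ w, #{e ∈ range m | Inc u v e w} ≤ 3)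
    (hm : m ≤ 2 * k + 2) :
    (moves u v m (range m) : ℝ) ≤ 3.4854 ^ k * ((3 * m + 1) * 7) := by
  rcases Nat.lt_or_ge n 2 with h1 | h2
  · obtain rfl : n = 1 := by omega
    have hm0 : m = 0 := by
      by_contra h
      exact hv.ne 0 (by omega) (Subsingleton.elim _ _)
    subst hm0
    have : (1 : ℝ) ≤ 3.4854 ^ k := one_le_pow₀ (by norm_num)
    simp only [moves, Nat.cast_one, Nat.cast_zero]
    linarith
  · have h3 := (hv.moves_le h2 m _ le_rfl Subset.rfl Subset.rfl hc).2
    have h4 := hv.potential_le h2 hc hdeg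
    have h5 : (1.8669 : ℝ) ^ m ≤ 3.4854 ^ k * 4 := by
      calc (1.8669 : ℝ) ^ m ≤ 1.8669 ^ (2 * k + 2) := pow_le_pow_right₀ (by norm_num) hm
        _ = (1.8669 ^ 2) ^ k * 1.8669 ^ 2 := by rw [pow_add, pow_mul]
        _ ≤ 3.4854 ^ k * 4 := by
          refine mul_le_mul (pow_le_pow_left₀ (by norm_num) (by norm_num) k) (by norm_num)
            (by norm_num) (by positivity)
    have h6 : (7 / 4 : ℝ) ^ n = (7 / 4) ^ (n - 1) * (7 / 4) := by
      rw [← pow_succ, Nat.sub_add_cancel (by omega)]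
    have h7 : potential u v m (range m) ≤ (7 / 4) ^ (n - 1) * (3.4854 ^ k * 7) := by
      refine h4.trans ((mul_le_mul_of_nonneg_left h5 (by positivity)).trans (le_of_eq ?_))
      rw [h6]
      ring
    refine le_of_mul_le_mul_left (h3.trans
      ((mul_le_mul_of_nonneg_left h7 (by positivity)).trans (le_of_eq ?_)))
      (show (0 : ℝ) < (7 / 4) ^ (n - 1) by positivity)
    ring

theorem Valid.card_inc_le (hv : Valid u v m) (hG : (graph u v (range m)).IsSubcubic)
    (w : Fin n) : #{e ∈ range m | Inc u v e w} ≤ 3 := by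
  classical
  have h := hG w
  rw [encard_neighborSet_eq_degree, hv.degree_graph Subset.rfl] at h
  exact_mod_cast h

theorem Valid.hasInternalSpanningTree (hv : Valid u v m)
    (hc : (graph u v (range m)).Connected) (hG : (graph u v (range m)).IsSubcubic)
    (hm : 2 * k + 3 ≤ m) : (graph u v (range m)).HasInternalSpanningTree k := by
  classical
  obtain ⟨T, hT, hle⟩ := hc.exists_isSpanningTree_card_edgeFinset_le fun w => by
    rw [hv.degree_graph Subset.rfl]
    exact hv.card_inc_le hG w
  rw [hv.card_edgeFinset Subset.rfl, card_range] at hle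
  refine ⟨T, hT, ?_⟩
  rw [SimpleGraph.encard_internalVertices]
  exact_mod_cast (show k ≤ _ by omega)

end EdgeList

/-! ### Polynomial time budgets and the memory layout of the search. -/

namespace RAM

infixr:60 "⨾" => Cmd.seq

/-- A loop with control register counting down from at most `B`, and time polynomial in `B`. -/
theorem Runs.loop_pow {P : Cmd} {a c d B : ℕ} (hd : d ≠ 0) (I : ℕ → State → Prop)
    (hreg : ∀ i s, I i s → s.reg a = i ∧ i ≤ B)
    (hstep : ∀ i s, I (i + 1) s → Runs P s (c * (B + 1) ^ d) (I i)) {m : ℕ} {s : State}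
    (h : I m s) : Runs (.loop a P) s ((c + 1) * (B + 1) ^ (d + 1)) (I 0) := by
  refine (Runs.loop I hreg hstep m s h).mono ?_ fun _ => id
  have hm := (hreg m s h).2
  have h1 : B + 1 ≤ (B + 1) ^ d := Nat.le_self_pow hd _
  calc m * (1 + B + c * (B + 1) ^ d) + (1 + B)
      ≤ B * ((B + 1) ^ d + c * (B + 1) ^ d) + (B + 1) ^ d :=
        Nat.add_le_add (Nat.mul_le_mul hm (by omega)) (by omega)
    _ ≤ B * ((B + 1) ^ d + c * (B + 1) ^ d) + ((B + 1) ^ d + c * (B + 1) ^ d) := by omega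
    _ = _ := by ring

/-- Execution of a program without loops from a state with values at most `B`. -/
theorem Runs.of_eval {P : Cmd} (hP : P.Flat) {s : State} {B : ℕ} (hs : s.Bdd B)
    {Q : State → Prop} (h : Q (P.eval s)) : Runs P s (P.cost * (B + 1) ^ 1) Q :=
  (Runs.flat P hP hs).mono (by rw [pow_one]) (by rintro _ ⟨rfl, -⟩; exact h)

theorem Runs.mono_pow {P : Cmd} {s : State} {B c C d D : ℕ} {Q : State → Prop}
    (h : Runs P s (c * (B + 1) ^ d) Q) (hd : d ≤ D) (hc : c ≤ C) :
    Runs P s (C * (B + 1) ^ D) Q :=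
  h.mono (Nat.mul_le_mul hc (Nat.pow_le_pow_right (Nat.succ_pos _) hd)) fun _ => id

/-- With the power of B + 1 fixed, a sequence is charged against one numeral C: the first command
takes c of it and C - c remains for the rest. -/
theorem Runs.seq_pow {P P' : Cmd} {s : State} {B c C d D : ℕ} {Q Q' : State → Prop}
    (h : Runs P s (c * (B + 1) ^ d) Q) (hd : d ≤ D) (hc : c ≤ C)
    (h' : ∀ s', Q s' → Runs P' s' ((C - c) * (B + 1) ^ D) Q') :
    Runs (P⨾P') s (C * (B + 1) ^ D) Q' :=
  ((h.mono_pow hd le_rfl).seq h').mono (by rw [← add_mul, Nat.add_sub_cancel' hc]) fun _ => id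

/-- Outside of the working registers `8, …, 15` and of the working memory, which starts at
`4 * n ^ 2`, the states agree. -/
def Keeps (n : ℕ) (s s' : State) : Prop :=
  (∀ r, r < 8 ∨ 15 < r → s'.reg r = s.reg r) ∧ ∀ a < 4 * (n * n), s'.mem a = s.mem a

theorem Keeps.refl (n : ℕ) (s : State) : Keeps n s s := ⟨fun _ _ => rfl, fun _ _ => rfl⟩

theorem Keeps.trans {n : ℕ} {s s' s'' : State} (h : Keeps n s s') (h' : Keeps n s' s'') :
    Keeps n s s'' :=
  ⟨fun r hr => (h'.1 r hr).trans (h.1 r hr), fun a ha => (h'.2 a ha).trans (h.2 a ha)⟩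

theorem Keeps.setReg {n d x : ℕ} {s s' : State} (h : Keeps n s s') (h1 : 8 ≤ d) (h2 : d ≤ 15) :
    Keeps n s (s'.setReg d x) := by
  refine ⟨fun r hr => ?_, h.2⟩
  rw [State.setReg_reg, if_neg (by omega)]
  exact h.1 r hr

theorem Keeps.setMem {n a x : ℕ} {s s' : State} (h : Keeps n s s') (ha : 4 * (n * n) ≤ a) :
    Keeps n s (s'.setMem a x) := by
  refine ⟨h.1, fun b hb => ?_⟩
  rw [State.setMem_mem, if_neg (by omega)]
  exact h.2 b hb

/-- The state holds the list of the `m` edges, with those in `A` marked as alive. -/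
structure Env {n : ℕ} (m B : ℕ) (u v : ℕ → Fin n) (A : Finset ℕ) (s : State) : Prop where
  reg0 : s.reg 0 = n
  reg2 : s.reg 2 = 1
  reg3 : s.reg 3 = n * n
  reg4 : s.reg 4 = 2 * (n * n)
  reg5 : s.reg 5 = 3 * (n * n)
  reg6 : s.reg 6 = 4 * (n * n)
  reg7 : s.reg 7 = m
  reg30 : s.reg 30 = 0
  hm : m ≤ n * n
  hB : 5 * (n * n) + n + 5 ≤ B
  bdd : s.Bdd B
  sub : A ⊆ Finset.range m
  memU : ∀ e < m, s.mem (n * n + e) = u e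
  memV : ∀ e < m, s.mem (2 * (n * n) + e) = v e
  memA : ∀ e < m, s.mem (3 * (n * n) + e) = if e ∈ A then 1 else 0

variable {n m B : ℕ} {u v : ℕ → Fin n} {A : Finset ℕ} {s s' : State}

theorem Env.of_keeps (h : Env m B u v A s) (hk : Keeps n s s') (hb : s'.Bdd B) :
    Env m B u v A s' where
  reg0 := (hk.1 _ (by norm_num)).trans h.reg0
  reg2 := (hk.1 _ (by norm_num)).trans h.reg2
  reg3 := (hk.1 _ (by norm_num)).trans h.reg3
  reg4 := (hk.1 _ (by norm_num)).trans h.reg4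
  reg5 := (hk.1 _ (by norm_num)).trans h.reg5
  reg6 := (hk.1 _ (by norm_num)).trans h.reg6
  reg7 := (hk.1 _ (by norm_num)).trans h.reg7
  reg30 := (hk.1 _ (by norm_num)).trans h.reg30
  hm := h.hm
  hB := h.hB
  bdd := hb
  sub := h.sub
  memU := fun e he => (hk.2 _ (by have := h.hm; omega)).trans (h.memU e he)
  memV := fun e he => (hk.2 _ (by have := h.hm; omega)).trans (h.memV e he)
  memA := fun e he => (hk.2 _ (by have := h.hm; omega)).trans (h.memA e he)

/-! ### Clearing the working memory -/

/-- Registers 2 and 30 hold 1 and 0 throughout, so subtracting register 2 decrements and adding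
register 30 copies. -/
def clearStep : Cmd := .sub 10 10 2 ⨾ .add 12 6 10 ⨾ .store 12 30

def clear : Cmd := .add 10 0 30 ⨾ .loop 10 clearStep

theorem runs_clear (h : Env m B u v A s) :
    Runs clear s ((2 + (clearStep.cost + 1)) * (B + 1) ^ 2) fun s' =>
      Keeps n s s' ∧ s'.Bdd B ∧ ∀ w : Fin n, s'.mem (4 * (n * n) + w) = 0 := by
  have hB := h.hB
  let I : ℕ → State → Prop := fun i s' => Keeps n s s' ∧ s'.Bdd B ∧ s'.reg 10 = i ∧ i ≤ n ∧
    ∀ w : Fin n, i ≤ w → s'.mem (4 * (n * n) + w) = 0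
  refine Runs.seq_pow (Q := I n) (Runs.of_eval (by trivial) h.bdd ?_) (by norm_num)
    (Nat.le_add_right _ _) (fun s' hs' =>
    ((Runs.loop_pow (B := B) (c := clearStep.cost) one_ne_zero I
      (fun i s' hs' => ⟨hs'.2.2.1, ?_⟩) (fun i s' hs' => ?_) hs').mono_pow le_rfl
        (by simp only [Cmd.cost]; omega)).mono le_rfl ?_)
  · simp only [Cmd.eval, h.reg0, h.reg30, add_zero]
    exact ⟨(Keeps.refl n s).setReg (by norm_num) (by norm_num), h.bdd.setReg (by omega),
      by simp, le_rfl, fun w hw => absurd hw (by omega)⟩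
  · have := hs'.2.2.2.1
    omega
  · obtain ⟨hk, hb, h10, hi, hz⟩ := hs'
    have h' := h.of_keeps hk hb
    refine Runs.of_eval (by simp [clearStep, Cmd.Flat]) hb ?_
    simp only [clearStep, Cmd.eval, State.setReg_reg, h10, h'.reg2, h'.reg6, h'.reg30,
      Nat.reduceEqDiff, if_true, if_false, Nat.add_sub_cancel]
    refine ⟨((hk.setReg (by norm_num) (by norm_num)).setReg (by norm_num) (by norm_num)).setMem
      (by omega), ((hb.setReg (by omega)).setReg (by omega)).setMem (by omega), by simp,
      by omega, fun w hw => ?_⟩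
    simp only [State.setMem_mem, State.setReg_mem]
    split_ifs with hwi
    · rfl
    · exact hz w (by omega)
  · rintro s' ⟨hk, hb, -, -, hz⟩
    exact ⟨hk, hb, fun w => hz w (Nat.zero_le _)⟩

/-! ### Testing connectivity -/

/-- Registers 8 and 9 receive the addresses of the marks of the two ends. The sum of the marks is
nonzero exactly if some end is marked, and then both are. -/
def relax : Cmd :=
  .sub 10 10 2 ⨾ .add 12 5 10 ⨾ .load 13 12 ⨾ .cond 13
    (.add 12 3 10 ⨾ .load 8 12 ⨾ .add 8 6 8 ⨾ .add 12 4 10 ⨾ .load 9 12 ⨾ .add 9 6 9 ⨾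
      .load 13 8 ⨾ .load 14 9 ⨾ .add 13 13 14 ⨾ .cond 13 (.store 8 2 ⨾ .store 9 2) .skip) .skip

open EdgeList in
/-- A pass over all edges that propagates marks along the edges that are alive. -/
theorem runs_relax (h : Env m B u v A s) (r : Fin n) {L : ℕ}
    (h01 : ∀ w : Fin n, s.mem (4 * (n * n) + w) ≤ 1)
    (hr : ∀ w : Fin n, s.mem (4 * (n * n) + w) ≠ 0 → (graph u v A).Reachable w r)
    (hL : ∀ w, (∃ p : (graph u v A).Walk w r, p.length ≤ L) → s.mem (4 * (n * n) + w) ≠ 0)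
    (h10 : s.reg 10 = m) :
    Runs (.loop 10 relax) s ((relax.cost + 1) * (B + 1) ^ 2) fun s' =>
      Keeps n s s' ∧ s'.Bdd B ∧ s'.reg 11 = s.reg 11 ∧
      (∀ w : Fin n, s'.mem (4 * (n * n) + w) ≤ 1) ∧
      (∀ w : Fin n, s'.mem (4 * (n * n) + w) ≠ 0 → (graph u v A).Reachable w r) ∧
      ∀ w, (∃ p : (graph u v A).Walk w r, p.length ≤ L + 1) → s'.mem (4 * (n * n) + w) ≠ 0 := by
  have hB := h.hB
  have hm := h.hm
  let I : ℕ → State → Prop := fun i s' => Keeps n s s' ∧ s'.Bdd B ∧ s'.reg 10 = i ∧ i ≤ m ∧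
    s'.reg 11 = s.reg 11 ∧ (∀ w : Fin n, s'.mem (4 * (n * n) + w) ≤ 1) ∧
    (∀ w : Fin n, s'.mem (4 * (n * n) + w) ≠ 0 → (graph u v A).Reachable w r) ∧
    (∀ w : Fin n, s.mem (4 * (n * n) + w) ≠ 0 → s'.mem (4 * (n * n) + w) ≠ 0) ∧
    -- The premise refers to the marks at the start of the pass, in s; marks made during the pass
    -- are not needed for the gain of one step in distance.
    ∀ e ∈ A, i ≤ e → s.mem (4 * (n * n) + u e) ≠ 0 ∨ s.mem (4 * (n * n) + v e) ≠ 0 →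
      s'.mem (4 * (n * n) + u e) ≠ 0 ∧ s'.mem (4 * (n * n) + v e) ≠ 0
  refine (Runs.loop_pow (c := relax.cost) one_ne_zero I (m := m) (fun i s' hs' => ⟨hs'.2.2.1, ?_⟩)
      (fun i s' hs' => ?_) ?_).mono le_rfl ?_
  · have := hs'.2.2.2.1
    omega
  · obtain ⟨hk, hb, h10, hi, h11, h01, hr, hmono, hpass⟩ := hs'
    have h' := h.of_keeps hk hb
    refine Runs.of_eval (by simp [relax, Cmd.Flat]) hb ?_
    have him : i < m := by omega
    have hu := (u i).2
    have hv := (v i).2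
    by_cases hiA : i ∈ A
    · have hadj : ∀ {a b : Fin n}, u i = a → v i = b → (graph u v A).Reachable a b := by
        rintro a b rfl rfl
        by_cases hne : u i = v i
        · rw [hne]
        · exact (graph_adj.2 ⟨⟨i, hiA, .inl ⟨rfl, rfl⟩⟩, hne⟩).reachable
      have h01u := h01 (u i)
      have h01v := h01 (v i)
      by_cases hmark : s'.mem (4 * (n * n) + u i) + s'.mem (4 * (n * n) + v i) = 0
      · simp only [relax, Cmd.eval, State.setReg_reg, State.setReg_mem, State.setMem_reg,
          h10, h'.reg2, h'.reg3, h'.reg4, h'.reg5, h'.reg6, h'.memA i him, hiA, h'.memU i him,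
          h'.memV i him, Nat.reduceEqDiff, if_true, if_false, Nat.add_sub_cancel, hmark]
        refine ⟨by
          repeat first
            | exact hk
            | refine Keeps.setReg ?_ (by norm_num) (by norm_num), by
          repeat first
            | exact hb
            | refine State.Bdd.setReg ?_ (by omega), by simp, by omega,
          by simpa using h11, h01, hr, hmono, fun e he hie hm => ?_⟩
        rcases hie.eq_or_lt with rfl | hie
        · have h1 := hmono (u i)
          have h2 := hmono (v i)
          omega
        · exact hpass e he hie hm
      · simp only [relax, Cmd.eval, State.setReg_reg, State.setReg_mem, State.setMem_reg,
          h10, h'.reg2, h'.reg3, h'.reg4, h'.reg5, h'.reg6, h'.memA i him, hiA, h'.memU i him,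
          h'.memV i him, Nat.reduceEqDiff, if_true, if_false, Nat.add_sub_cancel, hmark, one_ne_zero]
        have hri : (graph u v A).Reachable (u i) r ∧ (graph u v A).Reachable (v i) r := by
          by_cases h0 : s'.mem (4 * (n * n) + u i) = 0
          · have h1 := hr (v i) (by omega)
            exact ⟨(hadj rfl rfl).trans h1, h1⟩
          · have h1 := hr (u i) h0
            exact ⟨h1, (hadj rfl rfl).symm.trans h1⟩
        refine ⟨by
          repeat first
            | exact hk
            | refine Keeps.setReg ?_ (by norm_num) (by norm_num)
            | refine Keeps.setMem ?_ (by omega), by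
          repeat first
            | exact hb
            | refine State.Bdd.setReg ?_ (by omega)
            | refine State.Bdd.setMem ?_ (by omega), by simp, by omega, by simpa using h11, ?_⟩
        simp only [State.setMem_mem, State.setReg_mem, add_right_inj, Fin.val_inj]
        refine ⟨fun w => ?_, fun w hw => ?_, fun w hw => ?_, fun e he hie hm => ?_⟩
        · have := h01 w
          split_ifs <;> omega
        · split_ifs at hw with h1 h2
          · exact h1 ▸ hri.2
          · exact h2 ▸ hri.1
          · exact hr w hw
        · have := hmono w hw
          split_ifs <;> omega
        · rcases hie.eq_or_lt with rfl | hie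
          · simp
          · have := hpass e he hie hm
            split_ifs <;> omega
    · simp only [relax, Cmd.eval, State.setReg_reg, State.setReg_mem, State.setMem_reg,
          h10, h'.reg2, h'.reg3, h'.reg4, h'.reg5, h'.reg6, h'.memA i him, hiA, h'.memU i him,
          h'.memV i him, Nat.reduceEqDiff, if_true, if_false, Nat.add_sub_cancel]
      refine ⟨by
          repeat first
            | exact hk
            | refine Keeps.setReg ?_ (by norm_num) (by norm_num), by
          repeat first
            | exact hb
            | refine State.Bdd.setReg ?_ (by omega), by simp, by omega,
          by simpa using h11, h01, hr, hmono, fun e he hie hm => ?_⟩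
      refine hpass e he (lt_of_le_of_ne hie ?_) hm
      rintro rfl
      exact hiA he
  · exact ⟨Keeps.refl n s, h.bdd, h10, le_rfl, rfl, h01, hr, fun _ => id, fun e he hme =>
      absurd (Finset.mem_range.1 (h.sub he)) (by omega)⟩
  · rintro s' ⟨hk, hb, -, -, h11, h01, hr, hmono, hpass⟩
    refine ⟨hk, hb, h11, h01, hr, ?_⟩
    rintro w ⟨p, hp⟩
    cases p with
    | nil => exact hmono _ (hL _ ⟨.nil, Nat.zero_le _⟩)
    | @cons _ b _ hadj p =>
      have hb := hL b ⟨p, by simpa using hp⟩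
      obtain ⟨⟨e, he, ⟨rfl, rfl⟩ | ⟨rfl, rfl⟩⟩, -⟩ := graph_adj.1 hadj
      · exact (hpass e he (Nat.zero_le _) (.inr hb)).1
      · exact (hpass e he (Nat.zero_le _) (.inl hb)).2

def markAll : Cmd := .sub 11 11 2 ⨾ .add 10 7 30 ⨾ .loop 10 relax

def unmarked : Cmd := .sub 10 10 2 ⨾ .add 12 6 10 ⨾ .load 13 12 ⨾ .cond 13 .skip (.const 15 1)

/-- Sets register 15 to zero if and only if the graph formed by the edges that are alive is
connected. -/
def conn : Cmd :=
  clear ⨾ .store 6 2 ⨾ .add 11 0 30 ⨾ .loop 11 markAll ⨾ .const 15 0 ⨾ .add 10 0 30 ⨾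
    .loop 10 unmarked

/-- The cost factor of the connectivity test. -/
def connCost : ℕ := clearStep.cost + relax.cost + unmarked.cost + 20

open EdgeList in
theorem runs_unmarked (h : Env m B u v A s) (h10 : s.reg 10 = n) (h15 : s.reg 15 = 0) :
    Runs (.loop 10 unmarked) s ((unmarked.cost + 1) * (B + 1) ^ 2) fun s' =>
      Keeps n s s' ∧ s'.Bdd B ∧
        (s'.reg 15 = 0 ↔ ∀ w : Fin n, s.mem (4 * (n * n) + w) ≠ 0) := by
  have hB := h.hB
  let I : ℕ → State → Prop := fun i s' => Keeps n s s' ∧ s'.Bdd B ∧ s'.reg 10 = i ∧ i ≤ n ∧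
    (∀ w : Fin n, s'.mem (4 * (n * n) + w) = s.mem (4 * (n * n) + w)) ∧
    (s'.reg 15 = 0 ↔ ∀ w : Fin n, i ≤ w → s.mem (4 * (n * n) + w) ≠ 0)
  refine (Runs.loop_pow (c := unmarked.cost) one_ne_zero I (m := n)
    (fun i s' hs' => ⟨hs'.2.2.1, ?_⟩) (fun i s' hs' => ?_) ?_).mono le_rfl ?_
  · have := hs'.2.2.2.1
    omega
  · obtain ⟨hk, hb, h10, hi, hmem, h15⟩ := hs'
    have h' := h.of_keeps hk hb
    refine Runs.of_eval (by simp [unmarked, Cmd.Flat]) hb ?_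
    have him := hmem ⟨i, hi⟩
    have hbi := hb.2 (4 * (n * n) + i)
    dsimp only at him
    by_cases h0 : s.mem (4 * (n * n) + i) = 0
    · rw [h0] at him
      simp only [unmarked, Cmd.eval, State.setReg_reg, State.setReg_mem, h10, h'.reg2, h'.reg6,
        Nat.reduceEqDiff, if_true, if_false, Nat.add_sub_cancel, him]
      refine ⟨by
          repeat first
            | exact hk
            | refine Keeps.setReg ?_ (by norm_num) (by norm_num), by
          repeat first
            | exact hb
            | refine State.Bdd.setReg ?_ (by omega), by simp, by omega, hmem, ?_⟩
      simp only [State.setReg_reg, if_true, one_ne_zero, false_iff, not_forall]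
      exact ⟨⟨i, hi⟩, le_rfl, fun h => h h0⟩
    · have h0' := h0
      rw [← him] at h0'
      simp only [unmarked, Cmd.eval, State.setReg_reg, State.setReg_mem, h10, h'.reg2, h'.reg6,
        Nat.reduceEqDiff, if_true, if_false, Nat.add_sub_cancel, h0']
      refine ⟨by
          repeat first
            | exact hk
            | refine Keeps.setReg ?_ (by norm_num) (by norm_num), by
          repeat first
            | exact hb
            | refine State.Bdd.setReg ?_ (by omega), by simp, by omega, hmem, ?_⟩
      simp only [State.setReg_reg, Nat.reduceEqDiff, if_false, h15]
      refine forall_congr' fun w => ⟨fun hw hiw => ?_, fun hw hiw => hw (by omega)⟩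
      rcases hiw.eq_or_lt with rfl | hiw
      · exact h0
      · exact hw hiw
  · exact ⟨Keeps.refl n s, h.bdd, h10, le_rfl, fun _ => rfl, by
      simp only [h15, true_iff]
      exact fun w hw => absurd w.2 (by omega)⟩
  · rintro s' ⟨hk, hb, -, -, -, h15⟩
    exact ⟨hk, hb, by simpa using h15⟩

open EdgeList in
theorem connected_iff_forall_exists_walk [NeZero n] :
    (graph u v A).Connected ↔ ∀ w, (graph u v A).Reachable w 0 :=
  ⟨fun h w => h.preconnected w 0, fun h =>
    { preconnected := fun a b => (h a).trans (h b).symm }⟩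

-- Cell 4n² is the mark of vertex 0. Marks never leave its component, each pass extends them by one
-- step in distance, and paths have length less than n, so n passes reach the whole component.
open EdgeList in
theorem runs_conn [NeZero n] (h : Env m B u v A s) :
    Runs conn s (connCost * (B + 1) ^ 3) fun s' =>
      Keeps n s s' ∧ s'.Bdd B ∧ (s'.reg 15 = 0 ↔ (graph u v A).Connected) := by
  have hB := h.hB
  have hn : 0 < n := NeZero.pos n
  let I : ℕ → State → Prop := fun i s' => Keeps n s s' ∧ s'.Bdd B ∧ s'.reg 11 = i ∧ i ≤ n ∧
    (∀ w : Fin n, s'.mem (4 * (n * n) + w) ≤ 1) ∧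
    (∀ w : Fin n, s'.mem (4 * (n * n) + w) ≠ 0 → (graph u v A).Reachable w 0) ∧
    ∀ w, (∃ p : (graph u v A).Walk w 0, p.length ≤ n - i) → s'.mem (4 * (n * n) + w) ≠ 0
  refine Runs.seq_pow (runs_clear h) (by norm_num) (by simp only [connCost]; omega)
    fun s₁ ⟨hk, hb, hz⟩ => ?_
  refine Runs.seq_pow (Runs.of_eval (by trivial) hb rfl) (by norm_num)
    (by simp only [connCost, Cmd.cost]; omega) fun s₂ hs₂ => ?_
  have h₁ := h.of_keeps hk hb
  simp only [Cmd.eval, h₁.reg6, h₁.reg2] at hs₂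
  have hk₂ : Keeps n s s₂ := hs₂ ▸ hk.setMem le_rfl
  have hb₂ : s₂.Bdd B := hs₂ ▸ hb.setMem (by omega)
  have h₂ := h.of_keeps hk₂ hb₂
  have hm₂ : ∀ w : Fin n, s₂.mem (4 * (n * n) + w) = if w = 0 then 1 else 0 := by
    intro w
    simp [← hs₂, hz, Fin.val_eq_zero_iff]
  refine Runs.seq_pow (Runs.of_eval (Q := I n) (by trivial) hb₂ ?_) (by norm_num)
    (by simp only [connCost, Cmd.cost]; omega) fun s₃ hs₃ => ?_
  · simp only [Cmd.eval, h₂.reg0, h₂.reg30, add_zero]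
    refine ⟨hk₂.setReg (by norm_num) (by norm_num), hb₂.setReg (by omega), by simp, le_rfl, ?_⟩
    simp only [State.setReg_mem, hm₂]
    refine ⟨fun w => by split_ifs <;> omega, fun w hw => ?_, ?_⟩
    · split_ifs at hw with h0
      · rw [h0]
      · exact absurd rfl hw
    · rintro w ⟨p, hp⟩
      rw [Nat.sub_self, Nat.le_zero] at hp
      simp [SimpleGraph.Walk.eq_of_length_eq_zero hp]
  refine Runs.seq_pow (Runs.loop_pow (c := relax.cost + 5) two_ne_zero I
    (fun i s' hs' => ⟨hs'.2.2.1, ?_⟩) (fun i s' hs' => ?_) hs₃) le_rfl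
    (by simp only [connCost, Cmd.cost]; omega) fun s₄ ⟨hk₄, hb₄, _, _, _, hr₄, hL₄⟩ => ?_
  · have := hs'.2.2.2.1
    omega
  · obtain ⟨hk, hb, h11, hi, h01, hr, hL⟩ := hs'
    have h' := h.of_keeps hk hb
    refine Runs.seq_pow (Runs.of_eval (by trivial) hb rfl) (by norm_num)
      (by simp only [Cmd.cost]; omega) fun s₄ hs₄ => ?_
    simp only [Cmd.eval, h11, h'.reg2, Nat.add_sub_cancel] at hs₄
    have hk₄ : Keeps n s s₄ := hs₄ ▸ hk.setReg (by norm_num) (by norm_num)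
    have hb₄ : s₄.Bdd B := hs₄ ▸ hb.setReg (by omega)
    have h₄ := h.of_keeps hk₄ hb₄
    refine Runs.seq_pow (Runs.of_eval (by trivial) hb₄ rfl) (by norm_num)
      (by simp only [Cmd.cost]; omega) fun s₅ hs₅ => ?_
    simp only [Cmd.eval, h₄.reg7, h₄.reg30, add_zero] at hs₅
    have hk₅ : Keeps n s s₅ := hs₅ ▸ hk₄.setReg (by norm_num) (by norm_num)
    have hm := h.hm
    have hb₅ : s₅.Bdd B := hs₅ ▸ hb₄.setReg (by omega)
    have hmem : s₅.mem = s'.mem := by rw [← hs₅, ← hs₄]; rfl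
    refine ((runs_relax (h.of_keeps hk₅ hb₅) 0 (L := n - (i + 1)) (by rwa [hmem]) (by rwa [hmem])
      (by rwa [hmem]) (by simp [← hs₅])).mono_pow le_rfl (by simp only [Cmd.cost]; omega)).mono le_rfl
      fun s₆ ⟨hk₆, hb₆, h11₆, h01₆, hr₆, hL₆⟩ => ?_
    refine ⟨hk₅.trans hk₆, hb₆, h11₆.trans (by simp [← hs₅, ← hs₄]), by omega, h01₆, hr₆, ?_⟩
    rwa [show n - i = n - (i + 1) + 1 by omega]
  refine Runs.seq_pow (Runs.of_eval (by trivial) hb₄ rfl) (by norm_num)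
    (by simp only [connCost, Cmd.cost]; omega) fun s₅ hs₅ => ?_
  have hk₅ : Keeps n s s₅ := hs₅ ▸ hk₄.setReg (by norm_num) (by norm_num)
  have hb₅ : s₅.Bdd B := hs₅ ▸ hb₄.setReg (by omega)
  have h₅ := h.of_keeps hk₅ hb₅
  refine Runs.seq_pow (Runs.of_eval (by trivial) hb₅ rfl) (by norm_num)
    (by simp only [connCost, Cmd.cost]; omega) fun s₆ hs₆ => ?_
  simp only [Cmd.eval, h₅.reg0, h₅.reg30, add_zero] at hs₆
  have hk₆ : Keeps n s s₆ := hs₆ ▸ hk₅.setReg (by norm_num) (by norm_num)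
  have hb₆ : s₆.Bdd B := hs₆ ▸ hb₅.setReg (by omega)
  have hmem : s₆.mem = s₄.mem := by rw [← hs₆, ← hs₅]; rfl
  refine ((runs_unmarked (h.of_keeps hk₆ hb₆) (by simp [← hs₆])
    (by simp [← hs₆, ← hs₅, Cmd.eval])).mono_pow
    (by norm_num) (by simp only [connCost, Cmd.cost]; omega)).mono le_rfl
    fun s₇ ⟨hk₇, hb₇, h15₇⟩ => ⟨hk₆.trans hk₇, hb₇, ?_⟩
  rw [h15₇, hmem, connected_iff_forall_exists_walk]
  refine forall_congr' fun w => ⟨hr₄ w, fun ⟨p⟩ => hL₄ w ?_⟩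
  classical
  refine ⟨p.toPath, ?_⟩
  have := p.toPath.2.length_lt
  rw [Fintype.card_fin] at this
  omega

end RAM

namespace RAM

variable {n m B : ℕ} {u v : ℕ → Fin n} {A : Finset ℕ} {s s' : State}

/-! ### Counting edges and internal vertices -/

def degrees : Cmd :=
  .sub 10 10 2 ⨾ .add 12 5 10 ⨾ .load 13 12 ⨾ .cond 13
    (.add 12 3 10 ⨾ .load 8 12 ⨾ .add 8 6 8 ⨾ .load 13 8 ⨾ .add 13 13 2 ⨾ .store 8 13 ⨾
      .add 12 4 10 ⨾ .load 8 12 ⨾ .add 8 6 8 ⨾ .load 13 8 ⨾ .add 13 13 2 ⨾ .store 8 13 ⨾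
      .add 14 14 2) .skip

/-- The truncated difference of the degree and 1 is nonzero exactly for degree at least two. -/
def countInternal : Cmd :=
  .sub 10 10 2 ⨾ .add 12 6 10 ⨾ .load 13 12 ⨾ .sub 13 13 2 ⨾ .cond 13 (.add 15 15 2) .skip

/-- Sets register 13 to zero if and only if there are fewer than `n` edges alive and at least `k`
vertices have degree at least two. -/
def treeTest : Cmd :=
  clear ⨾ .const 14 1 ⨾ .add 10 7 30 ⨾ .loop 10 degrees ⨾ .const 15 0 ⨾ .add 10 0 30 ⨾
    .loop 10 countInternal ⨾ .sub 13 1 15 ⨾ .sub 14 14 0 ⨾ .add 13 13 14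

/-- The cost factor of the tree test. -/
def treeTestCost : ℕ := clearStep.cost + degrees.cost + countInternal.cost + 40

open EdgeList Finset

theorem card_filter_le_and_of_mem {p : ℕ → Prop} [DecidablePred p] {i : ℕ} (hi : i ∈ A)
    (hp : p i) : #{e ∈ A | i ≤ e ∧ p e} = #{e ∈ A | i + 1 ≤ e ∧ p e} + 1 := by
  rw [← card_insert_of_notMem (s := {e ∈ A | i + 1 ≤ e ∧ p e}) (a := i) (by simp)]
  congr 1
  ext e
  simp only [mem_filter, mem_insert]
  constructor
  · rintro ⟨h1, h2, h3⟩
    rcases h2.eq_or_lt with rfl | h2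
    exacts [.inl rfl, .inr ⟨h1, h2, h3⟩]
  · rintro (rfl | ⟨h1, h2, h3⟩)
    exacts [⟨hi, le_rfl, hp⟩, ⟨h1, by omega, h3⟩]

theorem filter_le_and_of_not {p : ℕ → Prop} [DecidablePred p] {i : ℕ}
    (hi : ¬ (i ∈ A ∧ p i)) : {e ∈ A | i ≤ e ∧ p e} = {e ∈ A | i + 1 ≤ e ∧ p e} := by
  ext e
  simp only [mem_filter]
  refine ⟨fun ⟨h1, h2, h3⟩ => ⟨h1, lt_of_le_of_ne h2 ?_, h3⟩, fun ⟨h1, h2, h3⟩ =>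
    ⟨h1, by omega, h3⟩⟩
  rintro rfl
  exact hi ⟨h1, h3⟩

theorem runs_degrees (h : Env m B u v A s) (hv : Valid u v m)
    (h0 : ∀ w : Fin n, s.mem (4 * (n * n) + w) = 0) (h10 : s.reg 10 = m) (h14 : s.reg 14 = 1) :
    Runs (.loop 10 degrees) s ((degrees.cost + 1) * (B + 1) ^ 2) fun s' =>
      Keeps n s s' ∧ s'.Bdd B ∧ s'.reg 14 = #A + 1 ∧
      ∀ w : Fin n, s'.mem (4 * (n * n) + w) = #{e ∈ A | Inc u v e w} := by
  have hB := h.hB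
  have hm := h.hm
  have hA : #A ≤ m := by simpa using card_le_card h.sub
  let I : ℕ → State → Prop := fun i s' => Keeps n s s' ∧ s'.Bdd B ∧ s'.reg 10 = i ∧ i ≤ m ∧
    -- The trivial conjunct lets the same filter lemmas serve for the number of edges and for the
    -- degrees.
    s'.reg 14 = #{e ∈ A | i ≤ e ∧ True} + 1 ∧
    ∀ w : Fin n, s'.mem (4 * (n * n) + w) = #{e ∈ A | i ≤ e ∧ Inc u v e w}
  refine (Runs.loop_pow (c := degrees.cost) one_ne_zero I (m := m)
    (fun i s' hs' => ⟨hs'.2.2.1, ?_⟩) (fun i s' hs' => ?_) ?_).mono le_rfl ?_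
  · have := hs'.2.2.2.1
    omega
  · obtain ⟨hk, hb, h10, hi, h14, hw⟩ := hs'
    have h' := h.of_keeps hk hb
    refine Runs.of_eval (by simp [degrees, Cmd.Flat]) hb ?_
    have him : i < m := by omega
    have hle : ∀ (p : ℕ → Prop) [DecidablePred p], #{e ∈ A | i + 1 ≤ e ∧ p e} ≤ m :=
      fun p _ => (card_filter_le _ _).trans hA
    by_cases hiA : i ∈ A
    · have hne := hv.ne i him
      have hne' : (4 * (n * n) + v i : ℕ) ≠ 4 * (n * n) + u i := by
        rw [Ne, add_right_inj, Fin.val_inj]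
        exact hne.symm
      have hu := (u i).2
      have hv := (v i).2
      have hle1 := hle fun e => Inc u v e (u i)
      have hle2 := hle fun e => Inc u v e (v i)
      have hle3 := hle fun e => True
      have hw' : ∀ w : Fin n, s'.mem (4 * (n * n) + w) = #{e ∈ A | i + 1 ≤ e ∧ Inc u v e w} := hw
      have hV : (2 * (n * n) + i) ≠ 4 * (n * n) + u i := by omega
      simp only [degrees, Cmd.eval, State.setReg_reg, State.setReg_mem, State.setMem_reg,
        State.setMem_mem, h10, h'.reg2, h'.reg3, h'.reg4, h'.reg5, h'.reg6, h'.memA i him, hiA,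
        h'.memU i him, h'.memV i him, Nat.reduceEqDiff, if_true, if_false, Nat.add_sub_cancel,
        one_ne_zero, hne', hV, h14, hw']
      refine ⟨by
          repeat first
            | exact hk
            | refine Keeps.setReg ?_ (by norm_num) (by norm_num)
            | refine Keeps.setMem ?_ (by omega), by
          repeat first
            | exact hb
            | refine State.Bdd.setReg ?_ (by omega)
            | refine State.Bdd.setMem ?_ (by omega), by simp, by omega, ?_, fun w => ?_⟩
      · simp only [State.setReg_reg, if_true]
        rw [card_filter_le_and_of_mem (p := fun _ => True) hiA trivial]
      · simp only [State.setMem_mem, State.setReg_mem, add_right_inj, Fin.val_inj]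
        split_ifs with h1 h2
        · subst h1
          rw [card_filter_le_and_of_mem (p := fun e => Inc u v e (v i)) hiA (.inr rfl)]
        · subst h2
          rw [card_filter_le_and_of_mem (p := fun e => Inc u v e (u i)) hiA (.inl rfl)]
        · rw [hw, filter_le_and_of_not (p := fun e => Inc u v e w) (i := i)]
          rintro ⟨-, rfl | rfl⟩
          exacts [h2 rfl, h1 rfl]
    · simp only [degrees, Cmd.eval, State.setReg_reg, State.setReg_mem, h10, h'.reg2, h'.reg5,
        h'.memA i him, hiA, Nat.reduceEqDiff, if_true, if_false, Nat.add_sub_cancel]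
      refine ⟨by
          repeat first
            | exact hk
            | refine Keeps.setReg ?_ (by norm_num) (by norm_num), by
          repeat first
            | exact hb
            | refine State.Bdd.setReg ?_ (by omega), by simp, by omega, ?_, fun w => ?_⟩
      · rw [filter_le_and_of_not (p := fun _ => True) fun h => hiA h.1]
        simpa using h14
      · rw [filter_le_and_of_not (p := fun e => Inc u v e w) fun h => hiA h.1]
        exact hw w
  · refine ⟨Keeps.refl n s, h.bdd, h10, le_rfl, ?_, fun w => ?_⟩
    · rw [h14, filter_false_of_mem, card_empty]
      intro e he
      have := mem_range.1 (h.sub he)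
      omega
    · rw [h0, filter_false_of_mem, card_empty]
      intro e he
      have := mem_range.1 (h.sub he)
      omega
  · rintro s' ⟨hk, hb, -, -, h14, hw⟩
    exact ⟨hk, hb, by simpa using h14, fun w => by simpa using hw w⟩

theorem runs_countInternal (h : Env m B u v A s)
    (hw : ∀ w : Fin n, s.mem (4 * (n * n) + w) = #{e ∈ A | Inc u v e w})
    (h10 : s.reg 10 = n) (h15 : s.reg 15 = 0) :
    Runs (.loop 10 countInternal) s ((countInternal.cost + 1) * (B + 1) ^ 2) fun s' =>
      Keeps n s s' ∧ s'.Bdd B ∧ s'.reg 14 = s.reg 14 ∧ s'.reg 15 = internal u v A := by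
  have hB := h.hB
  let I : ℕ → State → Prop := fun i s' => Keeps n s s' ∧ s'.Bdd B ∧ s'.reg 10 = i ∧ i ≤ n ∧
    s'.mem = s.mem ∧ s'.reg 14 = s.reg 14 ∧
    s'.reg 15 = #{w : Fin n | i ≤ w ∧ 2 ≤ #{e ∈ A | Inc u v e w}}
  refine (Runs.loop_pow (c := countInternal.cost) one_ne_zero I (m := n)
    (fun i s' hs' => ⟨hs'.2.2.1, ?_⟩) (fun i s' hs' => ?_) ?_).mono le_rfl ?_
  · have := hs'.2.2.2.1
    omega
  · obtain ⟨hk, hb, h10, hi, hmem, h14, h15⟩ := hs'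
    have h' := h.of_keeps hk hb
    refine Runs.of_eval (by simp [countInternal, Cmd.Flat]) hb ?_
    have him := hw ⟨i, hi⟩
    have hbi := hb.2 (4 * (n * n) + i)
    dsimp only at him
    rw [hmem, him] at hbi
    have hle : #{w : Fin n | i + 1 ≤ w ∧ 2 ≤ #{e ∈ A | Inc u v e w}} ≤ n := by
      simpa using card_le_univ {w : Fin n | i + 1 ≤ w ∧ 2 ≤ #{e ∈ A | Inc u v e w}}
    by_cases h2 : #{e ∈ A | Inc u v e ⟨i, hi⟩} - 1 = 0
    · simp only [countInternal, Cmd.eval, State.setReg_reg, State.setReg_mem, h10, h'.reg2,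
        h'.reg6, hmem, him, h2, Nat.reduceEqDiff, if_true, if_false, Nat.add_sub_cancel]
      refine ⟨by
          repeat first
            | exact hk
            | refine Keeps.setReg ?_ (by norm_num) (by norm_num), by
          repeat first
            | exact hb
            | refine State.Bdd.setReg ?_ (by omega), by simp, by omega, hmem, by simpa using h14,
            ?_⟩
      simp only [State.setReg_reg, Nat.reduceEqDiff, if_false, h15]
      congr 1
      ext w
      simp only [mem_filter, mem_univ, true_and]
      refine and_congr_left fun hw2 => ⟨fun h => by omega, fun h => lt_of_le_of_ne h ?_⟩
      rintro rfl
      exact absurd hw2 (by simpa using (by omega : #{e ∈ A | Inc u v e ⟨_, hi⟩} < 2))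
    · simp only [countInternal, Cmd.eval, State.setReg_reg, State.setReg_mem, h10, h'.reg2,
        h'.reg6, hmem, him, h2, Nat.reduceEqDiff, if_true, if_false, Nat.add_sub_cancel]
      refine ⟨by
          repeat first
            | exact hk
            | refine Keeps.setReg ?_ (by norm_num) (by norm_num), by
          repeat first
            | exact hb
            | refine State.Bdd.setReg ?_ (by omega), by simp, by omega, hmem, by simpa using h14,
            ?_⟩
      simp only [State.setReg_reg, if_true, h15]
      rw [← card_insert_of_notMem (a := (⟨i, hi⟩ : Fin n)) (by simp)]
      congr 1
      ext w
      simp only [mem_filter, mem_univ, true_and, mem_insert]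
      constructor
      · rintro (rfl | ⟨h1, h3⟩)
        exacts [⟨le_rfl, by omega⟩, ⟨by omega, h3⟩]
      · rintro ⟨h1, h3⟩
        rcases h1.eq_or_lt with h1 | h1
        exacts [.inl (Fin.ext h1.symm), .inr ⟨h1, h3⟩]
  · refine ⟨Keeps.refl n s, h.bdd, h10, le_rfl, rfl, rfl, ?_⟩
    rw [h15, filter_false_of_mem, card_empty]
    intro w _
    have := w.2
    omega
  · rintro s' ⟨hk, hb, -, -, -, h14, h15⟩
    exact ⟨hk, hb, h14, by simpa [internal] using h15⟩

/-- Register 13 becomes the sum of two truncated differences, which vanishes only if both do. Since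
register 14 counts from 1, this tests #A + 1 ≤ n; the reverse inequality will come from
connectedness. -/
theorem runs_treeTest {k : ℕ} (h : Env m B u v A s) (hv : Valid u v m) (h1 : s.reg 1 = k)
    (hkn : k ≤ n) :
    Runs treeTest s (treeTestCost * (B + 1) ^ 2) fun s' =>
      Keeps n s s' ∧ s'.Bdd B ∧ (s'.reg 13 = 0 ↔ #A + 1 ≤ n ∧ k ≤ internal u v A) := by
  have hB := h.hB
  have hm := h.hm
  have hA : #A ≤ m := by simpa using card_le_card h.sub
  refine Runs.seq_pow (runs_clear h) le_rfl (by simp only [treeTestCost]; omega)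
    fun s₁ ⟨hk₁, hb₁, hz⟩ => ?_
  refine Runs.seq_pow (Runs.of_eval (by trivial) hb₁ rfl) (by norm_num)
    (by simp only [treeTestCost, Cmd.cost]; omega) fun s₂ hs₂ => ?_
  have hk₂ : Keeps n s s₂ := hs₂ ▸ hk₁.setReg (by norm_num) (by norm_num)
  have hb₂ : s₂.Bdd B := hs₂ ▸ hb₁.setReg (by omega)
  have h₂ := h.of_keeps hk₂ hb₂
  refine Runs.seq_pow (Runs.of_eval (by trivial) hb₂ rfl) (by norm_num)
    (by simp only [treeTestCost, Cmd.cost]; omega) fun s₃ hs₃ => ?_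
  simp only [Cmd.eval, h₂.reg7, h₂.reg30, add_zero] at hs₃
  have hk₃ : Keeps n s s₃ := hs₃ ▸ hk₂.setReg (by norm_num) (by norm_num)
  have hb₃ : s₃.Bdd B := hs₃ ▸ hb₂.setReg (by omega)
  refine Runs.seq_pow (runs_degrees (h.of_keeps hk₃ hb₃) hv
      (by simpa [← hs₃, ← hs₂, Cmd.eval] using hz)
      (by simp [← hs₃]) (by simp [← hs₃, ← hs₂, Cmd.eval])) le_rfl
    (by simp only [treeTestCost, Cmd.cost]; omega) fun s₄ ⟨hk₄, hb₄, h14₄, hw₄⟩ => ?_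
  replace hk₄ := hk₃.trans hk₄
  refine Runs.seq_pow (Runs.of_eval (by trivial) hb₄ rfl) (by norm_num)
    (by simp only [treeTestCost, Cmd.cost]; omega) fun s₅ hs₅ => ?_
  have hk₅ : Keeps n s s₅ := hs₅ ▸ hk₄.setReg (by norm_num) (by norm_num)
  have hb₅ : s₅.Bdd B := hs₅ ▸ hb₄.setReg (by omega)
  have h₅ := h.of_keeps hk₅ hb₅
  refine Runs.seq_pow (Runs.of_eval (by trivial) hb₅ rfl) (by norm_num)
    (by simp only [treeTestCost, Cmd.cost]; omega) fun s₆ hs₆ => ?_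
  simp only [Cmd.eval, h₅.reg0, h₅.reg30, add_zero] at hs₆
  have hk₆ : Keeps n s s₆ := hs₆ ▸ hk₅.setReg (by norm_num) (by norm_num)
  have hb₆ : s₆.Bdd B := hs₆ ▸ hb₅.setReg (by omega)
  refine Runs.seq_pow (runs_countInternal (h.of_keeps hk₆ hb₆)
      (by simpa [← hs₆, ← hs₅, Cmd.eval] using hw₄)
      (by simp [← hs₆]) (by simp [← hs₆, ← hs₅, Cmd.eval])) le_rfl
    (by simp only [treeTestCost, Cmd.cost]; omega) fun s₇ ⟨hk₇, hb₇, h14₇, h15₇⟩ => ?_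
  replace hk₇ := hk₆.trans hk₇
  have h₇ := h.of_keeps hk₇ hb₇
  have h14 : s₇.reg 14 = #A + 1 := by simpa [h14₇, ← hs₆, ← hs₅, Cmd.eval] using h14₄
  have h1' : s₇.reg 1 = k := (hk₇.1 1 (by norm_num)).trans h1
  refine Runs.mono_pow (Runs.of_eval (by simp [Cmd.Flat]) hb₇ ?_) (by norm_num) ?_
  swap
  · simp only [treeTestCost, Cmd.cost, Cmd.growth]
    omega
  simp only [Cmd.eval, State.setReg_reg, h15₇, h14, h1', h₇.reg0, Nat.reduceEqDiff, if_true,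
    if_false]
  refine ⟨((hk₇.setReg (by norm_num) (by norm_num)).setReg (by norm_num) (by norm_num)).setReg
    (by norm_num) (by norm_num), ((hb₇.setReg (by omega)).setReg (by omega)).setReg (by omega),
    by omega⟩

end RAM

namespace RAM

/-! ### The backtracking search -/

/-- One move of the search. Register 16 holds the number of edges that are undecided, register 17
whether the search descends, register 18 whether it goes on, and register 19 whether it was
successful. -/
def move : Cmd :=
  .cond 17
    (.cond 16
      (.sub 16 16 2 ⨾ .add 12 5 16 ⨾ .store 12 30 ⨾ conn ⨾
        .cond 15 (.add 12 5 16 ⨾ .store 12 2) .skip)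
      (treeTest ⨾ .cond 13 .skip (.const 19 1) ⨾ .const 17 0))
    (.sub 12 7 16 ⨾ .cond 12
      (.add 12 5 16 ⨾ .load 13 12 ⨾ .cond 13 (.add 16 16 2) (.store 12 2 ⨾ .const 17 1))
      (.const 18 0))

/-- The cost factor of a move of the search. -/
def moveCost : ℕ := connCost + treeTestCost + 200

/-- The state of the search. -/
structure Conf {n : ℕ} (m B k : ℕ) (u v : ℕ → Fin n) (p d : ℕ) (ans : Prop) (A : Finset ℕ)
    (s : State) : Prop where
  env : Env m B u v A s
  reg1 : s.reg 1 = k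
  reg16 : s.reg 16 = p
  reg17 : s.reg 17 = d
  reg18 : s.reg 18 = 1
  reg19_le : s.reg 19 ≤ 1
  reg19 : s.reg 19 = 1 ↔ ans

variable {n m B k p d : ℕ} {u v : ℕ → Fin n} {A : Finset ℕ} {s s' : State} {ans : Prop}

open EdgeList Finset

theorem Env.setReg {r x : ℕ} (h : Env m B u v A s) (h8 : 8 ≤ r) (h30 : r ≠ 30) (hx : x ≤ B) :
    Env m B u v A (s.setReg r x) where
  reg0 := by rw [State.setReg_reg, if_neg (by omega), h.reg0]
  reg2 := by rw [State.setReg_reg, if_neg (by omega), h.reg2]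
  reg3 := by rw [State.setReg_reg, if_neg (by omega), h.reg3]
  reg4 := by rw [State.setReg_reg, if_neg (by omega), h.reg4]
  reg5 := by rw [State.setReg_reg, if_neg (by omega), h.reg5]
  reg6 := by rw [State.setReg_reg, if_neg (by omega), h.reg6]
  reg7 := by rw [State.setReg_reg, if_neg (by omega), h.reg7]
  reg30 := by rw [State.setReg_reg, if_neg (by omega), h.reg30]
  hm := h.hm
  hB := h.hB
  bdd := h.bdd.setReg hx
  sub := h.sub
  memU := h.memU
  memV := h.memV
  memA := h.memA

theorem Env.setMem {A' : Finset ℕ} {e x : ℕ} (h : Env m B u v A s)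
    (hA' : A' ⊆ range m) (hx : x = if e ∈ A' then 1 else 0)
    (hAA' : ∀ i, i ≠ e → (i ∈ A' ↔ i ∈ A)) : Env m B u v A' (s.setMem (3 * (n * n) + e) x) where
  reg0 := h.reg0
  reg2 := h.reg2
  reg3 := h.reg3
  reg4 := h.reg4
  reg5 := h.reg5
  reg6 := h.reg6
  reg7 := h.reg7
  reg30 := h.reg30
  hm := h.hm
  hB := h.hB
  bdd := h.bdd.setMem (by have := h.hB; split_ifs at hx <;> omega)
  sub := hA'
  memU := fun i hi => by
    have := h.hm
    rw [State.setMem_mem, if_neg (by omega), h.memU i hi]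
  memV := fun i hi => by
    have := h.hm
    rw [State.setMem_mem, if_neg (by omega), h.memV i hi]
  memA := fun i hi => by
    rw [State.setMem_mem]
    by_cases hie : i = e
    · rw [if_pos (by rw [hie]), hx, hie]
    · rw [if_neg (by omega), h.memA i hi]
      simp only [hAA' i hie]

theorem Conf.of_keeps (h : Conf m B k u v p d ans A s) (hk : Keeps n s s') (hb : s'.Bdd B) :
    Conf m B k u v p d ans A s' where
  env := h.env.of_keeps hk hb
  reg1 := (hk.1 _ (by norm_num)).trans h.reg1
  reg16 := (hk.1 _ (by norm_num)).trans h.reg16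
  reg17 := (hk.1 _ (by norm_num)).trans h.reg17
  reg18 := (hk.1 _ (by norm_num)).trans h.reg18
  reg19_le := (hk.1 _ (by norm_num)).trans_le h.reg19_le
  reg19 := by rw [hk.1 _ (by norm_num), h.reg19]

theorem Conf.bdd (h : Conf m B k u v p d ans A s) : s.Bdd B := h.env.bdd

theorem Runs.cond_pow {P P' : Cmd} {a B c D : ℕ} {Q : State → Prop} (hs : s.Bdd B) (hc : 1 ≤ c)
    (hD : 1 ≤ D) (h : s.reg a ≠ 0 → Runs P s ((c - 1) * (B + 1) ^ D) Q)
    (h' : s.reg a = 0 → Runs P' s ((c - 1) * (B + 1) ^ D) Q) :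
    Runs (.cond a P P') s (c * (B + 1) ^ D) Q := by
  refine (Runs.cond (hs.1 a) h h').mono ?_ fun _ => id
  have h1 : B + 1 ≤ (B + 1) ^ D := Nat.le_self_pow (by omega) _
  calc 1 + B + (c - 1) * (B + 1) ^ D ≤ (B + 1) ^ D + (c - 1) * (B + 1) ^ D := by omega
    _ = ((c - 1) + 1) * (B + 1) ^ D := by ring
    _ = c * (B + 1) ^ D := by rw [Nat.sub_add_cancel hc]

/-- Descending to the next edge: it is removed if this leaves the graph connected. -/
theorem runs_move_descend [NeZero n] (h : Conf m B k u v (p + 1) 1 ans A s) (hp : p < m)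
    (hpA : p ∈ A) :
    Runs move s (moveCost * (B + 1) ^ 3) fun s' =>
      ((graph u v (A.erase p)).Connected ∧ Conf m B k u v p 1 ans (A.erase p) s') ∨
      (¬ (graph u v (A.erase p)).Connected ∧ Conf m B k u v p 1 ans A s') := by
  have hB := h.env.hB
  have hm := h.env.hm
  refine Runs.cond_pow h.bdd (by simp only [moveCost]; omega) (by norm_num) (fun _ => ?_)
    (fun h0 => absurd h0 (by rw [h.reg17]; exact one_ne_zero))
  refine Runs.cond_pow h.bdd (by simp only [moveCost]; omega) (by norm_num) (fun _ => ?_)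
    (fun h0 => absurd h0 (by rw [h.reg16]; omega))
  refine Runs.seq_pow (Runs.of_eval (by trivial) h.bdd rfl) (by norm_num)
    (by simp only [moveCost, Cmd.cost]; omega) fun s₁ hs₁ => ?_
  simp only [Cmd.eval, h.reg16, h.env.reg2, Nat.add_sub_cancel] at hs₁
  have h₁ : Conf m B k u v p 1 ans A s₁ := by
    refine ⟨?_, ?_, ?_, ?_, ?_, ?_, ?_⟩
    · exact hs₁ ▸ h.env.setReg (by norm_num) (by norm_num) (by omega)
    all_goals simp [← hs₁, h.reg1, h.reg17, h.reg18, h.reg19_le, h.reg19]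
  refine Runs.seq_pow (Runs.of_eval (by trivial) h₁.bdd rfl) (by norm_num)
    (by simp only [moveCost, Cmd.cost]; omega) fun s₂ hs₂ => ?_
  simp only [Cmd.eval, h₁.env.reg5, h₁.reg16] at hs₂
  have h₂ : Conf m B k u v p 1 ans A s₂ := hs₂ ▸ h₁.of_keeps
    ((Keeps.refl n s₁).setReg (by norm_num) (by norm_num)) (h₁.bdd.setReg (by omega))
  refine Runs.seq_pow (Runs.of_eval (by trivial) h₂.bdd rfl) (by norm_num)
    (by simp only [moveCost, Cmd.cost]; omega) fun s₃ hs₃ => ?_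
  have h12 : s₂.reg 12 = 3 * (n * n) + p := by simp [← hs₂]
  simp only [Cmd.eval, h12, h₂.env.reg30] at hs₃
  have h₃ : Conf m B k u v p 1 ans (A.erase p) s₃ := by
    subst hs₃
    exact ⟨h₂.env.setMem ((erase_subset _ _).trans h.env.sub) (by simp)
      fun i hi => by simp [hi], h₂.reg1, h₂.reg16, h₂.reg17, h₂.reg18, h₂.reg19_le, h₂.reg19⟩
  refine Runs.seq_pow (runs_conn h₃.env) le_rfl
    (by simp only [moveCost, Cmd.cost]; omega) fun s₄ ⟨hk₄, hb₄, h15⟩ => ?_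
  have h₄ := h₃.of_keeps hk₄ hb₄
  refine Runs.cond_pow h₄.bdd (by simp only [moveCost, Cmd.cost]; omega) (by norm_num)
    (fun h0 => ?_) (fun h0 => ?_)
  · refine Runs.mono_pow (Runs.of_eval (by simp [Cmd.Flat]) h₄.bdd ?_) (by norm_num) ?_
    swap
    · simp only [moveCost, Cmd.cost, Cmd.growth]
      omega
    simp only [Cmd.eval, h₄.env.reg5, h₄.reg16, State.setReg_reg, Nat.reduceEqDiff, if_true,
      if_false, h₄.env.reg2]
    refine .inr ⟨fun hc => h0 (h15.2 hc), ?_⟩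
    have h₅ := h₄.of_keeps ((Keeps.refl n s₄).setReg (d := 12) (x := 3 * (n * n) + p)
      (by norm_num) (by norm_num)) (h₄.bdd.setReg (by omega))
    exact ⟨h₅.env.setMem h.env.sub (by simp [hpA]) fun i hi => by simp [hi],
      h₅.reg1, h₅.reg16, h₅.reg17, h₅.reg18, h₅.reg19_le, h₅.reg19⟩
  · refine Runs.mono_pow (Runs.of_eval (by trivial) h₄.bdd ?_) (by norm_num) ?_
    · exact .inl ⟨h15.1 h0, h₄⟩
    · simp only [moveCost, Cmd.cost]
      omega

/-- All edges are decided: the resulting tree is tested. -/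
theorem runs_move_test (h : Conf m B k u v 0 1 ans A s) (hv : Valid u v m) (hk : k ≤ n)
    (hc : (graph u v A).Connected) :
    Runs move s (moveCost * (B + 1) ^ 3)
      (Conf m B k u v 0 0 (ans ∨ Search u v k 0 A) A) := by
  have hB := h.env.hB
  refine Runs.cond_pow h.bdd (by simp only [moveCost]; omega) (by norm_num) (fun _ => ?_)
    (fun h0 => absurd h0 (by rw [h.reg17]; exact one_ne_zero))
  refine Runs.cond_pow h.bdd (by simp only [moveCost]; omega) (by norm_num)
    (fun h0 => absurd h.reg16 h0) (fun _ => ?_)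
  refine Runs.seq_pow (runs_treeTest h.env hv h.reg1 hk) (by norm_num)
    (by simp only [moveCost]; omega) fun s₁ ⟨hk₁, hb₁, h13⟩ => ?_
  have h₁ := h.of_keeps hk₁ hb₁
  have hs : s₁.reg 13 = 0 ↔ Search u v k 0 A := by
    have := hv.le_card h.env.sub hc
    rw [h13, Search]
    exact and_congr_left fun _ => ⟨fun _ => by omega, fun _ => by omega⟩
  refine Runs.mono_pow (Runs.of_eval (by simp [Cmd.Flat]) hb₁ ?_) (by norm_num) ?_
  swap
  · simp only [moveCost, Cmd.cost, Cmd.growth]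
    omega
  by_cases h0 : s₁.reg 13 = 0
  · simp only [Cmd.eval, h0, if_true]
    refine ⟨(h₁.env.setReg (by norm_num) (by norm_num) (by omega)).setReg (by norm_num)
      (by norm_num) (by omega), ?_, ?_, ?_, ?_, ?_, ?_⟩
    all_goals simp [h₁.reg1, h₁.reg16, h₁.reg18, hs.1 h0]
  · simp only [Cmd.eval, h0, if_false]
    refine ⟨h₁.env.setReg (by norm_num) (by norm_num) (by omega), ?_, ?_, ?_, ?_, ?_, ?_⟩
    all_goals simp [h₁.reg1, h₁.reg16, h₁.reg18, h₁.reg19_le, h₁.reg19, mt hs.2 h0]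

/-- Going back over an edge that was removed: the search now descends with this edge. -/
theorem runs_move_restore (h : Conf m B k u v p 0 ans A s) (hp : p < m) (hpA : p ∉ A) :
    Runs move s (moveCost * (B + 1) ^ 3) (Conf m B k u v p 1 ans (insert p A)) := by
  have hB := h.env.hB
  have hm := h.env.hm
  refine Runs.cond_pow h.bdd (by simp only [moveCost]; omega) (by norm_num)
    (fun h0 => absurd h.reg17 h0) (fun _ => ?_)
  refine Runs.mono_pow (Runs.of_eval (by simp [Cmd.Flat]) h.bdd ?_) (by norm_num) ?_
  swap
  · simp only [moveCost, Cmd.cost, Cmd.growth]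
    omega
  have hmp : m - p ≠ 0 := by omega
  simp only [Cmd.eval, h.env.reg7, h.reg16, State.setReg_reg, Nat.reduceEqDiff, if_true, if_false,
    hmp, h.env.reg5, State.setReg_mem, h.env.memA p hp, hpA, h.env.reg2]
  have h₁ := h.of_keeps ((((Keeps.refl n s).setReg (d := 12) (x := m - p) (by norm_num)
    (by norm_num)).setReg (d := 12) (x := 3 * (n * n) + p) (by norm_num) (by norm_num)).setReg
      (d := 13) (x := 0) (by norm_num) (by norm_num))
    (((h.bdd.setReg (by omega)).setReg (by omega)).setReg (by omega))
  have hsub : insert p A ⊆ range m := insert_subset (mem_range.2 hp) h.env.sub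
  refine ⟨(h₁.env.setMem hsub (by simp) fun i hi => by simp [hi]).setReg (by norm_num)
    (by norm_num) (by omega), ?_, ?_, ?_, ?_, ?_, ?_⟩
  all_goals simp [h.reg1, h.reg16, h.reg18, h.reg19_le, h.reg19]

/-- Going back over an edge that is present. -/
theorem runs_move_ascend (h : Conf m B k u v p 0 ans A s) (hp : p < m) (hpA : p ∈ A) :
    Runs move s (moveCost * (B + 1) ^ 3) (Conf m B k u v (p + 1) 0 ans A) := by
  have hB := h.env.hB
  have hm := h.env.hm
  refine Runs.cond_pow h.bdd (by simp only [moveCost]; omega) (by norm_num)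
    (fun h0 => absurd h.reg17 h0) (fun _ => ?_)
  refine Runs.mono_pow (Runs.of_eval (by simp [Cmd.Flat]) h.bdd ?_) (by norm_num) ?_
  swap
  · simp only [moveCost, Cmd.cost, Cmd.growth]
    omega
  have hmp : m - p ≠ 0 := by omega
  simp only [Cmd.eval, h.env.reg7, h.reg16, State.setReg_reg, Nat.reduceEqDiff, if_true, if_false,
    hmp, h.env.reg5, State.setReg_mem, h.env.memA p hp, hpA, h.env.reg2, one_ne_zero]
  have h₁ := h.of_keeps ((((Keeps.refl n s).setReg (d := 12) (x := m - p) (by norm_num)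
    (by norm_num)).setReg (d := 12) (x := 3 * (n * n) + p) (by norm_num) (by norm_num)).setReg
      (d := 13) (x := 1) (by norm_num) (by norm_num))
    (((h.bdd.setReg (by omega)).setReg (by omega)).setReg (by omega))
  refine ⟨h₁.env.setReg (by norm_num) (by norm_num) (by omega), ?_, ?_, ?_, ?_, ?_, ?_⟩
  all_goals simp [h.reg1, h.reg17, h.reg18, h.reg19_le, h.reg19]

/-- The search is complete. -/
theorem runs_move_stop (h : Conf m B k u v m 0 ans A s) :
    Runs move s (moveCost * (B + 1) ^ 3) fun s' =>
      s'.reg 18 = 0 ∧ s'.reg 19 ≤ 1 ∧ (s'.reg 19 = 1 ↔ ans) ∧ s'.Bdd B ∧ s'.reg 30 = 0 := by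
  refine Runs.cond_pow h.bdd (by simp only [moveCost]; omega) (by norm_num)
    (fun h0 => absurd h.reg17 h0) (fun _ => ?_)
  refine Runs.mono_pow (Runs.of_eval (by simp [Cmd.Flat]) h.bdd ?_) (by norm_num) ?_
  swap
  · simp only [moveCost, Cmd.cost, Cmd.growth]
    omega
  simp only [Cmd.eval, h.env.reg7, h.reg16, State.setReg_reg, if_true, Nat.sub_self]
  exact ⟨by simp, by simp [h.reg19_le], by simp [h.reg19],
    (h.bdd.setReg (Nat.zero_le _)).setReg (Nat.zero_le _), by simp [h.env.reg30]⟩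

/-- From `s`, the search reaches a state that satisfies `Q`, in time at most `T`. -/
def Reaches (s : State) (T : ℕ) (Q : State → Prop) : Prop :=
  ∃ t s', t ≤ T ∧ Q s' ∧
    ∀ t₁ s₁, Exec (.loop 18 move) s' t₁ s₁ → Exec (.loop 18 move) s (t + t₁) s₁

/-- The search loop has no counter that decreases. `Reaches` therefore describes a segment of its
run by how it prolongs any completion, and such segments can be glued along the recursion of
`Search`. -/
theorem Reaches.trans {T T' : ℕ} {Q Q' : State → Prop} (h : Reaches s T Q)
    (h' : ∀ s', Q s' → Reaches s' T' Q') : Reaches s (T + T') Q' := by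
  obtain ⟨t, s₁, h1, h2, h3⟩ := h
  obtain ⟨t', s₂, h4, h5, h6⟩ := h' s₁ h2
  exact ⟨t + t', s₂, add_le_add h1 h4, h5, fun t₁ s₃ h => by
    rw [add_assoc]
    exact h3 _ _ (h6 _ _ h)⟩

theorem Reaches.mono {T T' : ℕ} {Q Q' : State → Prop} (h : Reaches s T Q) (hT : T ≤ T')
    (hQ : ∀ s', Q s' → Q' s') : Reaches s T' Q' := by
  obtain ⟨t, s₁, h1, h2, h3⟩ := h
  exact ⟨t, s₁, h1.trans hT, hQ _ h2, h3⟩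

/-- The additional 2 is the cost of the loop test on the value 1. -/
theorem Runs.reaches {T : ℕ} {Q : State → Prop} (h : Runs move s T Q) (h18 : s.reg 18 = 1) :
    Reaches s (T + 2) Q := by
  obtain ⟨t, s', h1, h2, h3⟩ := h
  refine ⟨1 + (s.reg 18).size + t, s', ?_, h3, fun t₁ s₁ h =>
    .loop_true (by rw [h18]; exact one_ne_zero) h1 h⟩
  rw [h18, Nat.size_one]
  omega

/-- The flags act as the stack. On the way up, a dead edge p means that the branch keeping p is
still open; an alive one means that both branches are finished or that the deletion was refused.
This works because each call returns with the same A that it was given. -/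
theorem reaches_search [NeZero n] (hv : Valid u v m) (hk : k ≤ n) :
    ∀ (p : ℕ) (A : Finset ℕ) (ans : Prop) (s : State), p ≤ m → range p ⊆ A →
      (graph u v A).Connected → Conf m B k u v p 1 ans A s →
      Reaches s (moves u v p A * (moveCost * (B + 1) ^ 3 + 2))
        (Conf m B k u v p 0 (ans ∨ Search u v k p A) A)
  | 0, A, ans, s, _, _, hc, h => by
    simpa [moves] using (runs_move_test h hv hk hc).reaches h.reg18
  | p + 1, A, ans, s, hp, hpA, hc, h => by
    classical
    have hpA' : p ∈ A := hpA (by simp)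
    have hsub : range p ⊆ A := (range_subset_range.2 (Nat.le_succ p)).trans hpA
    have hsub' : range p ⊆ A.erase p := fun e he =>
      mem_erase.2 ⟨(mem_range.1 he).ne, hsub he⟩
    have hup : ∀ (ans' : Prop) (s' : State), Conf m B k u v p 1 ans' A s' →
        Reaches s' (moves u v p A * (moveCost * (B + 1) ^ 3 + 2) + (moveCost * (B + 1) ^ 3 + 2))
          (Conf m B k u v (p + 1) 0 (ans' ∨ Search u v k p A) A) := fun ans' s' h' =>
      (reaches_search hv hk p A ans' s' (by omega) hsub hc h').trans fun s₁ h₁ =>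
        (runs_move_ascend h₁ hp hpA').reaches h₁.reg18
    have hdown := (runs_move_descend h hp hpA').reaches h.reg18
    by_cases hc' : (graph u v (A.erase p)).Connected
    · refine (hdown.trans (T' := moves u v p (A.erase p) * (moveCost * (B + 1) ^ 3 + 2) +
        ((moveCost * (B + 1) ^ 3 + 2) + (moves u v p A * (moveCost * (B + 1) ^ 3 + 2) +
          (moveCost * (B + 1) ^ 3 + 2)))) fun s₁ h₁ => ?_).mono ?_ fun _ => id
      · have h₁ := (h₁.resolve_right fun h => h.1 hc').2
        refine (reaches_search hv hk p _ ans s₁ (by omega) hsub' hc' h₁).trans fun s₂ h₂ => ?_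
        refine ((runs_move_restore h₂ hp (by simp)).reaches h₂.reg18).trans fun s₃ h₃ => ?_
        rw [insert_erase hpA'] at h₃
        refine (hup _ s₃ h₃).mono le_rfl fun s₄ h₄ => ?_
        rw [Search]
        simpa only [hc', true_and, or_assoc] using h₄
      · rw [moves, if_pos hc']
        exact le_of_eq (by ring)
    · refine (hdown.trans fun s₁ h₁ => hup ans s₁ (h₁.resolve_left fun h => hc' h.1).2).mono ?_
        fun s₂ h₂ => ?_
      · rw [moves, if_neg hc']
        generalize moveCost * (B + 1) ^ 3 + 2 = τ
        rw [add_mul]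
        omega
      · rw [Search]
        simpa only [hc', false_and, false_or] using h₂

theorem runs_search [NeZero n] (hv : Valid u v m) (hk : k ≤ n)
    (hc : (graph u v (range m)).Connected) (h : Conf m B k u v m 1 False (range m) s) :
    Runs (.loop 18 move) s
      ((moves u v m (range m) + 1) * (moveCost * (B + 1) ^ 3 + 2) + 1) fun s' =>
        s'.reg 19 ≤ 1 ∧ (s'.reg 19 = 1 ↔ Search u v k m (range m)) ∧ s'.Bdd B ∧
          s'.reg 30 = 0 := by
  obtain ⟨t, s₁, h1, ⟨h2, h3⟩, h4⟩ := (reaches_search hv hk m _ False s le_rfl Subset.rfl hc h).trans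
    fun s₁ h₁ => (runs_move_stop h₁).reaches h₁.reg18
  refine ⟨_, s₁, h4 _ _ (.loop_false _ h2), ?_, by simpa using h3⟩
  rw [h2, Nat.size_zero, add_mul, one_mul]
  omega

end RAM

namespace RAM

/-! ### Building the list of edges -/

def square : Cmd := .sub 10 10 2 ⨾ .add 3 3 0

/-- Row and column are counted backwards in registers 8 and 9 along with the cell index, which
avoids division by n. At column 0 the row drops and the column is set to n before the common
decrement. -/
def scanIndex : Cmd :=
  .sub 10 10 2 ⨾ .cond 9 .skip (.sub 8 8 2 ⨾ .add 9 0 30) ⨾ .sub 9 9 2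

/-- Only cells above the diagonal, where column minus row does not truncate to 0, are recorded, so
the symmetric matrix yields each edge once. -/
def scanEdge : Cmd :=
  .load 13 10 ⨾ .cond 13 (.sub 14 9 8 ⨾ .cond 14
    (.add 12 3 7 ⨾ .store 12 8 ⨾ .add 12 4 7 ⨾ .store 12 9 ⨾ .add 12 5 7 ⨾ .store 12 2 ⨾
      .add 7 7 2) .skip) .skip

def scan : Cmd := scanIndex ⨾ scanEdge

/-- Builds the list of edges from the adjacency matrix. -/
def build : Cmd :=
  .add 10 0 30 ⨾ .loop 10 square ⨾ .add 4 3 3 ⨾ .add 5 4 3 ⨾ .add 6 5 3 ⨾ .add 10 3 30 ⨾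
    .add 8 0 30 ⨾ .loop 10 scan

/-- The cost factor of building the list of edges. -/
def buildCost : ℕ := square.cost + scanIndex.cost + scanEdge.cost + 100

open EdgeList Finset

/-- The list of edges contains precisely the edges in the cells `q, q + 1, …` of the adjacency
matrix, each once. -/
structure Scan {n : ℕ} (G : SimpleGraph (Fin n)) (k B q m : ℕ) (u v : ℕ → Fin n) (s : State) :
    Prop where
  reg0 : s.reg 0 = n
  reg1 : s.reg 1 = k
  reg2 : s.reg 2 = 1
  reg3 : s.reg 3 = n * n
  reg4 : s.reg 4 = 2 * (n * n)
  reg5 : s.reg 5 = 3 * (n * n)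
  reg6 : s.reg 6 = 4 * (n * n)
  reg7 : s.reg 7 = m
  reg19 : s.reg 19 = 0
  reg30 : s.reg 30 = 0
  hm : m + q ≤ n * n
  hB : 5 * (n * n) + n + 5 ≤ B
  bdd : s.Bdd B
  mem : ∀ a < n * n, s.mem a = (input G k).mem a
  memU : ∀ e < m, s.mem (n * n + e) = u e
  memV : ∀ e < m, s.mem (2 * (n * n) + e) = v e
  memA : ∀ e < m, s.mem (3 * (n * n) + e) = 1
  edge : ∀ e < m, G.Adj (u e) (v e) ∧ (u e : ℕ) < v e ∧ q ≤ u e * n + v e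
  mono : ∀ e e', e < e' → e' < m → (u e' * n + v e' : ℕ) < u e * n + v e
  all : ∀ a b : Fin n, G.Adj a b → (a : ℕ) < b → q ≤ a * n + b → ∃ e < m, u e = a ∧ v e = b

variable {n m B k q : ℕ} {G : SimpleGraph (Fin n)} {u v : ℕ → Fin n} {s s' : State}

theorem Scan.setReg {r x : ℕ} (h : Scan G k B q m u v s) (h8 : 8 ≤ r) (h15 : r ≤ 15)
    (hx : x ≤ B) : Scan G k B q m u v (s.setReg r x) where
  reg0 := by rw [State.setReg_reg, if_neg (by omega), h.reg0]
  reg1 := by rw [State.setReg_reg, if_neg (by omega), h.reg1]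
  reg2 := by rw [State.setReg_reg, if_neg (by omega), h.reg2]
  reg3 := by rw [State.setReg_reg, if_neg (by omega), h.reg3]
  reg4 := by rw [State.setReg_reg, if_neg (by omega), h.reg4]
  reg5 := by rw [State.setReg_reg, if_neg (by omega), h.reg5]
  reg6 := by rw [State.setReg_reg, if_neg (by omega), h.reg6]
  reg7 := by rw [State.setReg_reg, if_neg (by omega), h.reg7]
  reg19 := by rw [State.setReg_reg, if_neg (by omega), h.reg19]
  reg30 := by rw [State.setReg_reg, if_neg (by omega), h.reg30]
  hm := h.hm
  hB := h.hB
  bdd := h.bdd.setReg hx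
  mem := h.mem
  memU := h.memU
  memV := h.memV
  memA := h.memA
  edge := h.edge
  mono := h.mono
  all := h.all

theorem index_inj {i j a b : ℕ} (hj : j < n) (hb : b < n) (h : i * n + j = a * n + b) :
    i = a ∧ j = b := by
  have key : ∀ {c d : ℕ}, d < n → (c * n + d) / n = c := fun {c d} hd => by
    rw [mul_comm, Nat.mul_add_div (by omega), Nat.div_eq_of_lt hd, add_zero]
  have hia : i = a := by rw [← key (c := i) hj, h, key hb]
  subst hia
  exact ⟨rfl, by omega⟩

theorem input_mem {i j : ℕ} (hi : i < n) (hj : j < n) [Decidable (G.Adj ⟨i, hi⟩ ⟨j, hj⟩)] :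
    (input G k).mem (i * n + j) = if G.Adj ⟨i, hi⟩ ⟨j, hj⟩ then 1 else 0 := by
  have key : (∃ a b : Fin n, i * n + j = (a : ℕ) * n + b ∧ G.Adj a b) ↔
      G.Adj ⟨i, hi⟩ ⟨j, hj⟩ := by
    refine ⟨?_, fun h => ⟨⟨i, hi⟩, ⟨j, hj⟩, rfl, h⟩⟩
    rintro ⟨a, b, h1, h2⟩
    obtain ⟨rfl, rfl⟩ := index_inj hj b.2 h1
    exact h2
  by_cases hG : G.Adj ⟨i, hi⟩ ⟨j, hj⟩
  · rw [if_pos hG]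
    exact if_pos (key.2 hG)
  · rw [if_neg hG]
    exact if_neg (mt key.1 hG)

/-- A cell of the adjacency matrix that does not give rise to a new edge. -/
theorem Scan.skip {i j : ℕ} (h : Scan G k B (q + 1) m u v s) (hi : i < n) (hj : j < n)
    (hq : q = i * n + j) (hG : ¬ (G.Adj ⟨i, hi⟩ ⟨j, hj⟩ ∧ i < j)) : Scan G k B q m u v s :=
  { h with
    hm := by have := h.hm; omega
    edge := fun e he => by
      obtain ⟨h1, h2, h3⟩ := h.edge e he
      exact ⟨h1, h2, by omega⟩
    all := fun a b hab hlt hqab => by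
      rcases hqab.eq_or_lt with heq | hlt'
      · obtain ⟨rfl, rfl⟩ := index_inj hj b.2 (hq.symm.trans heq)
        exact absurd ⟨hab, hlt⟩ hG
      · exact h.all a b hab hlt hlt' }

/-- A cell of the adjacency matrix that gives rise to a new edge. -/
theorem Scan.push {i j : ℕ} (h : Scan G k B (q + 1) m u v s) (hi : i < n) (hj : j < n)
    (hq : q = i * n + j) (hG : G.Adj ⟨i, hi⟩ ⟨j, hj⟩) (hij : i < j) (x₁ x₂ x₃ : ℕ)
    (hx₁ : x₁ ≤ B) (hx₂ : x₂ ≤ B) (hx₃ : x₃ ≤ B) :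
    Scan G k B q (m + 1) (Function.update u m ⟨i, hi⟩) (Function.update v m ⟨j, hj⟩)
      (((((((s.setReg 12 x₁).setMem (n * n + m) i).setReg 12 x₂).setMem (2 * (n * n) + m) j).setReg
        12 x₃).setMem (3 * (n * n) + m) 1).setReg 7 (m + 1)) := by
  have hm := h.hm
  have hB := h.hB
  have hlast : ∀ {e}, e < m + 1 → e < m ∨ e = m := fun he => by omega
  constructor
  case reg7 => simp
  case hm => omega
  case hB => exact hB
  case bdd =>
    repeat first
      | exact h.bdd
      | refine State.Bdd.setReg ?_ (by omega)
      | refine State.Bdd.setMem ?_ (by omega)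
  case mem =>
    intro a ha
    simp only [State.setReg_mem, State.setMem_mem]
    rw [if_neg (by omega), if_neg (by omega), if_neg (by omega), h.mem a ha]
  case memU =>
    intro e he
    simp only [State.setReg_mem, State.setMem_mem]
    rcases hlast he with he | rfl
    · rw [if_neg (by omega), if_neg (by omega), if_neg (by omega), h.memU e he,
        Function.update_of_ne he.ne]
    · rw [if_neg (by omega), if_neg (by omega), if_pos rfl, Function.update_self]
  case memV =>
    intro e he
    simp only [State.setReg_mem, State.setMem_mem]
    rcases hlast he with he | rfl
    · rw [if_neg (by omega), if_neg (by omega), if_neg (by omega), h.memV e he,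
        Function.update_of_ne he.ne]
    · rw [if_neg (by omega), if_pos rfl, Function.update_self]
  case memA =>
    intro e he
    simp only [State.setReg_mem, State.setMem_mem]
    rcases hlast he with he | rfl
    · rw [if_neg (by omega), if_neg (by omega), if_neg (by omega), h.memA e he]
    · rw [if_pos rfl]
  case edge =>
    intro e he
    rcases hlast he with he | rfl
    · rw [Function.update_of_ne he.ne, Function.update_of_ne he.ne]
      obtain ⟨h1, h2, h3⟩ := h.edge e he
      exact ⟨h1, h2, by omega⟩
    · rw [Function.update_self, Function.update_self]
      exact ⟨hG, hij, hq.le⟩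
  case mono =>
    intro e e' hee' he'
    rw [Function.update_of_ne (by omega : e ≠ m), Function.update_of_ne (by omega : e ≠ m)]
    rcases hlast he' with he' | rfl
    · rw [Function.update_of_ne he'.ne, Function.update_of_ne he'.ne]
      exact h.mono e e' hee' he'
    · rw [Function.update_self, Function.update_self]
      have := (h.edge e hee').2.2
      dsimp only
      omega
  case all =>
    intro a b hab hlt hqab
    rcases hqab.eq_or_lt with heq | hlt'
    · obtain ⟨h1, h2⟩ := index_inj hj b.2 (hq.symm.trans heq)
      refine ⟨m, Nat.lt_succ_self m, ?_, ?_⟩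
      · rw [Function.update_self]
        exact Fin.ext h1
      · rw [Function.update_self]
        exact Fin.ext h2
    · obtain ⟨e, he, h1, h2⟩ := h.all a b hab hlt hlt'
      refine ⟨e, by omega, ?_, ?_⟩
      · rwa [Function.update_of_ne he.ne]
      · rwa [Function.update_of_ne he.ne]
  all_goals simp [h.reg0, h.reg1, h.reg2, h.reg3, h.reg4, h.reg5, h.reg6, h.reg19, h.reg30]

/-- Cell indices strictly decrease along the list, so no pair is repeated, and the smaller end comes
first, so none reappears reversed. -/
theorem Scan.valid (h : Scan G k B q m u v s) : Valid u v m where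
  ne e he heq := by
    have := (h.edge e he).2.1
    rw [heq] at this
    exact lt_irrefl _ this
  inj := by
    have key : ∀ e e', e < e' → e' < m → s(u e, v e) ≠ s(u e', v e') := by
      intro e e' hlt he' heq
      have h1 := h.mono e e' hlt he'
      have h2 := (h.edge e (hlt.trans he')).2.1
      have h3 := (h.edge e' he').2.1
      rcases Sym2.eq_iff.1 heq with ⟨h4, h5⟩ | ⟨h4, h5⟩
      · rw [h4, h5] at h1
        exact lt_irrefl _ h1
      · rw [h4, h5] at h2
        omega
    intro e he e' he' heq
    rcases lt_trichotomy e e' with hlt | rfl | hlt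
    exacts [absurd heq (key e e' hlt he'), rfl, absurd heq.symm (key e' e hlt he)]

theorem Scan.graph_eq (h : Scan G k B 0 m u v s) : graph u v (range m) = G := by
  ext a b
  rw [graph_adj]
  constructor
  · rintro ⟨⟨e, he, ⟨rfl, rfl⟩ | ⟨rfl, rfl⟩⟩, -⟩
    · exact (h.edge e (mem_range.1 he)).1
    · exact (h.edge e (mem_range.1 he)).1.symm
  · intro hab
    refine ⟨?_, hab.ne⟩
    rcases lt_or_gt_of_ne (Fin.val_ne_of_ne hab.ne) with hlt | hlt
    · obtain ⟨e, he, h1, h2⟩ := h.all a b hab hlt (Nat.zero_le _)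
      exact ⟨e, mem_range.2 he, .inl ⟨h1, h2⟩⟩
    · obtain ⟨e, he, h1, h2⟩ := h.all b a hab.symm hlt (Nat.zero_le _)
      exact ⟨e, mem_range.2 he, .inr ⟨h1, h2⟩⟩

theorem Scan.env (h : Scan G k B 0 m u v s) : Env m B u v (range m) s where
  reg0 := h.reg0
  reg2 := h.reg2
  reg3 := h.reg3
  reg4 := h.reg4
  reg5 := h.reg5
  reg6 := h.reg6
  reg7 := h.reg7
  reg30 := h.reg30
  hm := by simpa using h.hm
  hB := h.hB
  bdd := h.bdd
  sub := Subset.rfl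
  memU := h.memU
  memV := h.memV
  memA e he := by rw [h.memA e he, if_pos (mem_range.2 he)]

/-- The loop invariant of the pass over the adjacency matrix. -/
def ScanAt (G : SimpleGraph (Fin n)) (k B q : ℕ) (s : State) : Prop :=
  ∃ m u v i j, Scan G k B q m u v s ∧ s.reg 8 = i ∧ s.reg 9 = j ∧ s.reg 10 = q ∧
    q = i * n + j ∧ j < n ∧ i ≤ n

theorem runs_scan (h : ScanAt G k B (q + 1) s) :
    Runs scan s ((scanIndex.cost + scanEdge.cost) * (B + 1) ^ 1) (ScanAt G k B q) := by
  classical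
  obtain ⟨m, u, v, i, j, h, h8, h9, h10, hq, hj, hi⟩ := h
  have hm := h.hm
  have hB := h.hB
  refine Runs.seq_pow (Q := fun s' => Scan G k B (q + 1) m u v s' ∧ ∃ i j, s'.reg 8 = i ∧
      s'.reg 9 = j ∧ s'.reg 10 = q ∧ q = i * n + j ∧ j < n ∧ i < n)
    (Runs.of_eval (by simp [scanIndex, Cmd.Flat]) h.bdd ?_) le_rfl (Nat.le_add_right _ _)
    fun s₁ ⟨h₁, i', j', h8', h9', h10', hq', hj', hi'⟩ => ?_
  · by_cases hj0 : j = 0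
    · subst hj0
      obtain ⟨i, rfl⟩ : ∃ i', i = i' + 1 := Nat.exists_eq_succ_of_ne_zero (by rintro rfl; omega)
      simp only [scanIndex, Cmd.eval, State.setReg_reg, h8, h9, h10, h.reg2, h.reg0, h.reg30,
        Nat.reduceEqDiff, if_true, if_false, Nat.add_sub_cancel, add_zero]
      refine ⟨(((h.setReg (by norm_num) (by norm_num) (by omega)).setReg (by norm_num)
        (by norm_num) (by omega)).setReg (by norm_num) (by norm_num) (by omega)).setReg
        (by norm_num) (by norm_num) (by omega), i, n - 1, by simp, by simp, by simp, ?_, by omega,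
        hi⟩
      rw [add_mul, one_mul] at hq
      omega
    · simp only [scanIndex, Cmd.eval, State.setReg_reg, h8, h9, h10, h.reg2, hj0,
        Nat.reduceEqDiff, if_true, if_false, Nat.add_sub_cancel]
      refine ⟨(h.setReg (by norm_num) (by norm_num) (by omega)).setReg (by norm_num)
        (by norm_num) (by omega), i, j - 1, by simp, by simp, by simp, by omega, by omega,
        lt_of_le_of_ne hi ?_⟩
      rintro rfl
      omega
  · rw [Nat.add_sub_cancel_left]
    have hmem : s₁.mem q = if G.Adj ⟨i', hi'⟩ ⟨j', hj'⟩ then 1 else 0 := by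
      rw [h₁.mem q (by omega), hq', input_mem hi' hj']
    refine Runs.of_eval (by simp [scanEdge, Cmd.Flat]) h₁.bdd ?_
    by_cases hG : G.Adj ⟨i', hi'⟩ ⟨j', hj'⟩
    · by_cases hij : j' - i' = 0
      · simp only [scanEdge, Cmd.eval, State.setReg_reg, h8', h9', h10', hmem, hG, hij,
          Nat.reduceEqDiff, if_true, if_false, one_ne_zero]
        exact ⟨m, u, v, i', j', ((h₁.setReg (by norm_num) (by norm_num) (by omega)).setReg
          (by norm_num) (by norm_num) (by omega)).skip hi' hj' hq' fun h => by omega,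
          by simp [h8'], by simp [h9'], by simp [h10'], hq', hj', hi'.le⟩
      · simp only [scanEdge, Cmd.eval, State.setReg_reg, State.setMem_reg, h8', h9', h10', hmem,
          hG, hij, h₁.reg2, h₁.reg3, h₁.reg4, h₁.reg5, h₁.reg7, Nat.reduceEqDiff, if_true,
          if_false, one_ne_zero]
        exact ⟨m + 1, _, _, i', j', ((h₁.setReg (by norm_num) (by norm_num) (by omega)).setReg
          (by norm_num) (by norm_num) (by omega)).push hi' hj' hq' hG (by omega) _ _ _ (by omega)
            (by omega) (by omega),
          by simp [h8'], by simp [h9'], by simp [h10'], hq', hj', hi'.le⟩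
    · simp only [scanEdge, Cmd.eval, State.setReg_reg, h10', hmem, hG, if_true, if_false]
      exact ⟨m, u, v, i', j', (h₁.setReg (by norm_num) (by norm_num) (by omega)).skip hi' hj' hq'
        fun h => hG h.1, by simp [h8'], by simp [h9'], by simp [h10'], hq', hj', hi'.le⟩

end RAM

/-! ### Initialisation and the complete pass over the adjacency matrix. -/

namespace RAM

open EdgeList Finset

variable {n m B k q : ℕ} {G : SimpleGraph (Fin n)} {u v : ℕ → Fin n} {s s' : State}

theorem runs_square (hs : s.Bdd B) (hB : n * n + n ≤ B) (h0 : s.reg 0 = n) (h2 : s.reg 2 = 1)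
    (h3 : s.reg 3 = 0) (h10 : s.reg 10 = n) :
    Runs (.loop 10 square) s ((square.cost + 1) * (B + 1) ^ 2) fun s' =>
      s'.Bdd B ∧ s'.mem = s.mem ∧ (∀ r, r ≠ 3 → r ≠ 10 → s'.reg r = s.reg r) ∧
        s'.reg 3 = n * n := by
  let I : ℕ → State → Prop := fun i s' => s'.Bdd B ∧ s'.mem = s.mem ∧
    (∀ r, r ≠ 3 → r ≠ 10 → s'.reg r = s.reg r) ∧ s'.reg 3 + i * n = n * n ∧ s'.reg 10 = i ∧ i ≤ n
  refine (Runs.loop_pow (c := square.cost) one_ne_zero I (m := n)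
    (fun i s' hs' => ⟨hs'.2.2.2.2.1, hs'.2.2.2.2.2.trans (by omega)⟩)
    (fun i s' hs' => ?_) ?_).mono le_rfl ?_
  · obtain ⟨hb, hmem, hreg, h3, h10, hi⟩ := hs'
    refine Runs.of_eval (by simp [square, Cmd.Flat]) hb ?_
    have h0' : s'.reg 0 = n := (hreg 0 (by norm_num) (by norm_num)).trans h0
    have h2' : s'.reg 2 = 1 := (hreg 2 (by norm_num) (by norm_num)).trans h2
    rw [add_mul, one_mul] at h3
    simp only [square, Cmd.eval, State.setReg_reg, h10, h2', h0', Nat.reduceEqDiff, if_false,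
      Nat.add_sub_cancel]
    refine ⟨(hb.setReg (by omega)).setReg (by omega), hmem, fun r hr3 hr10 => ?_, ?_, by simp,
      by omega⟩
    · rw [State.setReg_reg, if_neg hr3, State.setReg_reg, if_neg hr10, hreg r hr3 hr10]
    · rw [State.setReg_reg, if_pos rfl]
      omega
  · exact ⟨hs, rfl, fun _ _ _ => rfl, by rw [h3, zero_add], h10, le_rfl⟩
  · rintro s' ⟨hb, hmem, hreg, h3, -, -⟩
    exact ⟨hb, hmem, hreg, by simpa using h3⟩

/-- The state in which the construction of the list of edges starts. -/
noncomputable def start (G : SimpleGraph (Fin n)) (k : ℕ) : State := (input G k).setReg 2 1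

theorem input_bdd (hk : k ≤ B) (hn : n ≤ B) (hB : 1 ≤ B) : (input G k).Bdd B := by
  refine ⟨fun r => ?_, fun a => ?_⟩
  · simp only [input]
    split_ifs <;> omega
  · simp only [input]
    split_ifs <;> omega

theorem runs_build (hn : n ≠ 0) (hk : k ≤ n) (hB : 5 * (n * n) + n + 5 ≤ B) :
    Runs build (start G k) (buildCost * (B + 1) ^ 2) fun s' =>
      ∃ m u v, Scan G k B 0 m u v s' := by
  have hinp : (start G k).Bdd B :=
    (input_bdd (by omega) (by omega) (by omega)).setReg (by omega)
  have hreg : ∀ r, (start G k).reg r = if r = 2 then 1 else if r = 0 then n else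
      if r = 1 then k else 0 := by
    intro r
    simp [start, input]
  refine Runs.seq_pow (Runs.of_eval (by trivial) hinp rfl) (by norm_num)
    (by simp only [buildCost, Cmd.cost]; omega) fun s₁ hs₁ => ?_
  simp only [Cmd.eval, hreg, Nat.reduceEqDiff, if_true, if_false, add_zero] at hs₁
  refine Runs.seq_pow (runs_square (n := n) (s := s₁) (hs₁ ▸ hinp.setReg (by omega)) (by omega)
    (by simp [← hs₁, hreg]) (by simp [← hs₁, hreg]) (by simp [← hs₁, hreg]) (by simp [← hs₁]))
    le_rfl (by simp only [buildCost, Cmd.cost]; omega) fun s₂ ⟨hb₂, hm₂, hr₂, h3⟩ => ?_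
  have hreg₂ : ∀ r, r ≠ 3 → r ≠ 10 → s₂.reg r = if r = 2 then 1 else if r = 0 then n else
      if r = 1 then k else 0 := by
    intro r h3 h10
    rw [hr₂ r h3 h10, ← hs₁, State.setReg_reg, if_neg h10, hreg]
  have hmem₂ : s₂.mem = (input G k).mem := by
    rw [hm₂, ← hs₁]
    rfl
  refine Runs.seq_pow (Runs.of_eval (by trivial) hb₂ rfl) (by norm_num)
    (by simp only [buildCost, Cmd.cost]; omega) fun s₃ hs₃ => ?_
  simp only [Cmd.eval, h3] at hs₃
  have hb₃ : s₃.Bdd B := hs₃ ▸ hb₂.setReg (by omega)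
  refine Runs.seq_pow (Runs.of_eval (by trivial) hb₃ rfl) (by norm_num)
    (by simp only [buildCost, Cmd.cost]; omega) fun s₄ hs₄ => ?_
  simp only [Cmd.eval, ← hs₃, State.setReg_reg, Nat.reduceEqDiff, if_true, if_false, h3] at hs₄
  have hb₄ : s₄.Bdd B := hs₄ ▸ (hb₂.setReg (by omega)).setReg (by omega)
  refine Runs.seq_pow (Runs.of_eval (by trivial) hb₄ rfl) (by norm_num)
    (by simp only [buildCost, Cmd.cost]; omega) fun s₅ hs₅ => ?_
  simp only [Cmd.eval, ← hs₄, State.setReg_reg, Nat.reduceEqDiff, if_true, if_false, h3] at hs₅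
  have hscan : Scan G k B (n * n) 0 (fun _ => ⟨0, Nat.pos_of_ne_zero hn⟩)
      (fun _ => ⟨0, Nat.pos_of_ne_zero hn⟩) s₅ := by
    subst hs₅
    constructor
    case hm => omega
    case hB => exact hB
    case bdd => exact ((hb₂.setReg (by omega)).setReg (by omega)).setReg (by omega)
    case mem => exact fun a _ => congrFun hmem₂ a
    case memU => exact fun e he => absurd he (Nat.not_lt_zero e)
    case memV => exact fun e he => absurd he (Nat.not_lt_zero e)
    case memA => exact fun e he => absurd he (Nat.not_lt_zero e)
    case edge => exact fun e he => absurd he (Nat.not_lt_zero e)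
    case mono => exact fun e e' _ he => absurd he (Nat.not_lt_zero e')
    case all =>
      intro a b _ _ hle
      have h1 : ((a : ℕ) + 1) * n ≤ n * n := Nat.mul_le_mul_right n a.2
      rw [add_mul, one_mul] at h1
      have := b.2
      omega
    all_goals simp [hreg₂, h3]
    all_goals omega
  have hz₅ : s₅.reg 9 = 0 := by simp [← hs₅, hreg₂]
  refine Runs.seq_pow (Runs.of_eval (by trivial) hscan.bdd rfl) (by norm_num)
    (by simp only [buildCost, Cmd.cost]; omega) fun s₆ hs₆ => ?_
  simp only [Cmd.eval, hscan.reg3, hscan.reg30, add_zero] at hs₆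
  have hscan₆ : Scan G k B (n * n) 0 _ _ s₆ :=
    hs₆ ▸ hscan.setReg (by norm_num) (by norm_num) (by omega)
  refine Runs.seq_pow (Runs.of_eval (by trivial) hscan₆.bdd rfl) (by norm_num)
    (by simp only [buildCost, Cmd.cost]; omega) fun s₇ hs₇ => ?_
  simp only [Cmd.eval, hscan₆.reg0, hscan₆.reg30, add_zero] at hs₇
  have hscan₇ : Scan G k B (n * n) 0 _ _ s₇ :=
    hs₇ ▸ hscan₆.setReg (by norm_num) (by norm_num) (by omega)
  refine ((Runs.loop_pow (B := B) (a := 10) (s := s₇) (m := n * n) one_ne_zero (ScanAt G k B)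
    (fun i s' ⟨_, _, _, _, _, h, _, _, h10, _⟩ => ⟨h10, ?_⟩)
    (fun i s' h => runs_scan h) ?_).mono_pow le_rfl ?_).mono le_rfl ?_
  · have := h.hm
    have := h.hB
    omega
  -- The pass starts one past the last cell, n · n = n · n + 0, that is in row n and column 0; this
  -- is why the invariant allows row n.
  · exact ⟨_, _, _, n, 0, hscan₇, by simp [← hs₇], by simp [← hs₇, ← hs₆, hz₅],
      by simp [← hs₇, ← hs₆], rfl, Nat.pos_of_ne_zero hn, le_rfl⟩
  · simp only [buildCost, Cmd.cost]
    omega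
  · rintro s' ⟨m, u, v, _, _, h, -⟩
    exact ⟨m, u, v, h⟩

/-! ### The algorithm -/

/-- Decides the problem once the list of edges is known and connectivity has been tested. -/
def decideTree : Cmd :=
  .cond 15 (.const 0 0)
    (.add 12 1 1 ⨾ .sub 12 7 12 ⨾ .sub 12 12 2 ⨾ .sub 12 12 2 ⨾ .cond 12 (.const 0 1)
      (.add 16 7 30 ⨾ .const 17 1 ⨾ .const 18 1 ⨾ .loop 18 move ⨾ .add 0 19 30))

/-- Decides whether a subcubic graph has a spanning tree with at least `k` internal vertices. -/
def algorithm : Cmd :=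
  .cond 0 (.sub 2 1 0 ⨾ .cond 2 (.const 0 0) (.const 2 1 ⨾ build ⨾ conn ⨾ decideTree)) .skip

/-- Register 0 holds the truth value of `A`. -/
def Answer (A : Prop) (s : State) : Prop := (A → s.reg 0 = 1) ∧ (¬ A → s.reg 0 = 0)

theorem Runs.seq_eval {P P' : Cmd} {T : ℕ} {Q : State → Prop} (hP : P.Flat) (hs : s.Bdd B)
    (hT : P.cost * (B + 1) ≤ T) (h : Runs P' (P.eval s) (T - P.cost * (B + 1)) Q) :
    Runs (P⨾P') s T Q :=
  ((Runs.of_eval hP hs (Q := fun s' => s' = P.eval s) rfl).seq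
    (fun s' hs' => hs' ▸ h)).mono (by rw [pow_one]; omega) fun _ => id

theorem Runs.cond_sub {P P' : Cmd} {a T : ℕ} {Q : State → Prop} (hs : s.Bdd B) (hT : B + 1 ≤ T)
    (h : s.reg a ≠ 0 → Runs P s (T - (B + 1)) Q) (h' : s.reg a = 0 → Runs P' s (T - (B + 1)) Q) :
    Runs (.cond a P P') s T Q :=
  (Runs.cond (hs.1 a) h h').mono (by omega) fun _ => id

/-- The budget T is left free, and the cost of the search is required of it only when the search is
actually started. -/
theorem runs_decideTree_aux [NeZero n] (h : Scan G k B 0 m u v s) (hk : k ≤ n)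
    (hG : G.IsSubcubic) (h15 : s.reg 15 = 0 ↔ G.Connected) {T : ℕ} (hT : 50 * (B + 1) ≤ T)
    (hT' : G.Connected → m ≤ 2 * k + 2 →
      (moves u v m (range m) + 1) * (moveCost * (B + 1) ^ 3 + 2) + 50 * (B + 1) ≤ T) :
    Runs decideTree s T (Answer (G.HasInternalSpanningTree k)) := by
  have hB := h.hB
  have hm := h.env.hm
  have hgraph := h.graph_eq
  have hv := h.valid
  have hn := Nat.le_mul_self n
  refine Runs.cond_sub h.bdd (by omega) (fun h0 => ?_) (fun h0 => ?_)
  · refine (Runs.of_eval (by trivial) h.bdd ?_).mono (t := (Cmd.const 0 0).cost * (B + 1) ^ 1)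
      (by simp only [Cmd.cost, pow_one]; omega) fun _ => id
    refine ⟨fun ⟨T, hT, _⟩ => absurd (h15.2 (hT.2.connected.mono hT.1)) h0, fun _ => ?_⟩
    simp [Cmd.eval]
  have hc := h15.1 h0
  refine Runs.seq_eval (by trivial) h.bdd (by simp only [Cmd.cost]; omega) ?_
  simp only [Cmd.eval, h.reg1]
  have h₁ : Scan G k B 0 m u v (s.setReg 12 (k + k)) :=
    h.setReg (by norm_num) (by norm_num) (by omega)
  refine Runs.seq_eval (by trivial) h₁.bdd (by simp only [Cmd.cost]; omega) ?_
  simp only [Cmd.eval, h₁.reg7, State.setReg_reg, if_true]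
  have h₂ := h₁.setReg (r := 12) (x := m - (k + k)) (by norm_num) (by norm_num) (by omega)
  refine Runs.seq_eval (by trivial) h₂.bdd (by simp only [Cmd.cost]; omega) ?_
  simp only [Cmd.eval, h₂.reg2, State.setReg_reg, if_true]
  have h₃ := h₂.setReg (r := 12) (x := m - (k + k) - 1) (by norm_num) (by norm_num) (by omega)
  refine Runs.seq_eval (by trivial) h₃.bdd (by simp only [Cmd.cost]; omega) ?_
  simp only [Cmd.eval, h₃.reg2, State.setReg_reg, if_true]
  have h₄ := h₃.setReg (r := 12) (x := m - (k + k) - 1 - 1) (by norm_num) (by norm_num) (by omega)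
  refine Runs.cond_sub h₄.bdd (by simp only [Cmd.cost]; omega) (fun h12 => ?_) (fun h12 => ?_)
  -- Register 12 holds m - 2k - 2, truncated, so it is nonzero exactly if m ≥ 2k + 3, where the tree
  -- exists without any search.
  · rw [State.setReg_reg, if_pos rfl] at h12
    refine (Runs.of_eval (by trivial) h₄.bdd ?_).mono (t := (Cmd.const 0 1).cost * (B + 1) ^ 1)
      (by simp only [Cmd.cost, pow_one]; omega) fun _ => id
    refine ⟨fun _ => by simp [Cmd.eval], fun hno => absurd ?_ hno⟩
    rw [← hgraph] at hc hG ⊢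
    exact hv.hasInternalSpanningTree hc hG (by omega)
  rw [State.setReg_reg, if_pos rfl] at h12
  replace hT' := hT' hc (by omega)
  refine Runs.seq_eval (by trivial) h₄.bdd (by simp only [Cmd.cost]; omega) ?_
  simp only [Cmd.eval, h₄.reg7, h₄.reg30, add_zero]
  have hb₅ := h₄.bdd.setReg (d := 16) (x := m) (by omega)
  refine Runs.seq_eval (by trivial) hb₅ (by simp only [Cmd.cost]; omega) ?_
  simp only [Cmd.eval]
  have hb₆ := hb₅.setReg (d := 17) (x := 1) (by omega)
  refine Runs.seq_eval (by trivial) hb₆ (by simp only [Cmd.cost]; omega) ?_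
  simp only [Cmd.eval]
  have hconf : Conf m B k u v m 1 False (range m)
      ((((s.setReg 12 (k + k)).setReg 12 (m - (k + k))).setReg 12 (m - (k + k) - 1)).setReg 12
        (m - (k + k) - 1 - 1) |>.setReg 16 m |>.setReg 17 1 |>.setReg 18 1) := by
    refine ⟨((h₄.env.setReg (by norm_num) (by norm_num) (by omega)).setReg (by norm_num)
      (by norm_num) (by omega)).setReg (by norm_num) (by norm_num) (by omega), ?_, ?_, ?_, ?_,
      ?_, ?_⟩
    all_goals simp [h.reg1, h.reg19]
  have hs := runs_search hv hk (hgraph.symm ▸ hc) hconf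
  refine (hs.seq fun s' ⟨h19, hans, hb, h30⟩ => Runs.of_eval (by trivial) hb ?_).mono
    (by simp only [Cmd.cost, pow_one]; omega) fun _ => id
  rw [← hgraph, ← hv.search_iff_hasInternalSpanningTree (hgraph.symm ▸ hc), ← hans]
  simp only [Cmd.eval, h30, add_zero]
  refine ⟨fun h => ?_, fun h => ?_⟩
  · simpa using h
  · simp only [State.setReg_reg, if_true]
    omega

/-- Running times are natural numbers, hence the floor of the real bound. In units of (`moveCost` +
2)(B + 1)^3 the cost is at most the number of moves plus 51: one for the stopping move and 50 for
the surrounding commands. Since m ≤ B, 7(3B + 1) + 51 = 21B + 58 covers the factor beside 3.4854^k.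
-/
theorem runs_decideTree [NeZero n] (h : Scan G k B 0 m u v s) (hk : k ≤ n) (hG : G.IsSubcubic)
    (h15 : s.reg 15 = 0 ↔ G.Connected) :
    Runs decideTree s
      ⌊(3.4854 : ℝ) ^ k * (((21 * B + 60) * ((moveCost + 2) * (B + 1) ^ 3) : ℕ) : ℝ)⌋₊
      (Answer (G.HasInternalSpanningTree k)) := by
  have hB := h.hB
  have hm := h.env.hm
  have hpow : (1 : ℝ) ≤ 3.4854 ^ k := one_le_pow₀ (by norm_num)
  have hX : B + 1 ≤ (B + 1) ^ 3 := Nat.le_self_pow (by norm_num) _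
  have hY : B + 1 ≤ (moveCost + 2) * (B + 1) ^ 3 :=
    hX.trans (Nat.le_mul_of_pos_left _ (by omega))
  have hZ : moveCost * (B + 1) ^ 3 + 2 ≤ (moveCost + 2) * (B + 1) ^ 3 := by
    rw [add_mul]
    omega
  have haux := fun T => runs_decideTree_aux (T := T) h hk hG h15
  generalize moveCost * (B + 1) ^ 3 + 2 = τ at hZ haux
  generalize (moveCost + 2) * (B + 1) ^ 3 = Y at hY hZ
  by_cases hsmall : G.Connected ∧ m ≤ 2 * k + 2
  · refine (haux ((moves u v m (range m) + 51) * Y) ?_ fun _ _ => ?_).mono ?_ fun _ => id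
    · exact Nat.mul_le_mul (by omega) hY
    · calc (moves u v m (range m) + 1) * τ + 50 * (B + 1)
          ≤ (moves u v m (range m) + 1) * Y + 50 * Y :=
            Nat.add_le_add (Nat.mul_le_mul_left _ hZ) (Nat.mul_le_mul_left _ hY)
        _ = _ := by ring
    · obtain ⟨hc, hmk⟩ := hsmall
      have hgraph := h.graph_eq
      have hmoves := h.valid.moves_root_le (NeZero.ne n) (hgraph.symm ▸ hc)
        (h.valid.card_inc_le (hgraph.symm ▸ hG)) hmk
      have hmB : (m : ℝ) ≤ B := by exact_mod_cast (by omega : m ≤ B)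
      refine Nat.le_floor ?_
      push_cast
      calc ((moves u v m (range m) : ℝ) + 51) * Y
          ≤ (3.4854 ^ k * ((3 * B + 1) * 7) + 3.4854 ^ k * 51) * Y := by
            refine mul_le_mul_of_nonneg_right (add_le_add (hmoves.trans ?_) ?_)
              (Nat.cast_nonneg _)
            · exact mul_le_mul_of_nonneg_left (by linarith) (by positivity)
            · linarith
        _ = 3.4854 ^ k * ((21 * B + 58) * Y) := by ring
        _ ≤ 3.4854 ^ k * ((21 * B + 60) * Y) := by
            refine mul_le_mul_of_nonneg_left ?_ (by positivity)
            exact mul_le_mul_of_nonneg_right (by linarith) (Nat.cast_nonneg _)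
  · refine (haux _ le_rfl fun hc hmk => absurd ⟨hc, hmk⟩ hsmall).mono ?_ fun _ => id
    refine Nat.le_floor ?_
    have h1 : 50 * (B + 1) ≤ (21 * B + 60) * Y := Nat.mul_le_mul (by omega) hY
    calc ((50 * (B + 1) : ℕ) : ℝ) ≤ _ := Nat.cast_le.2 h1
      _ ≤ _ := le_mul_of_one_le_left (Nat.cast_nonneg _) hpow

theorem Scan.of_keeps (h : Scan G k B q m u v s) (hk : Keeps n s s') (hb : s'.Bdd B) :
    Scan G k B q m u v s' where
  reg0 := (hk.1 _ (by norm_num)).trans h.reg0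
  reg1 := (hk.1 _ (by norm_num)).trans h.reg1
  reg2 := (hk.1 _ (by norm_num)).trans h.reg2
  reg3 := (hk.1 _ (by norm_num)).trans h.reg3
  reg4 := (hk.1 _ (by norm_num)).trans h.reg4
  reg5 := (hk.1 _ (by norm_num)).trans h.reg5
  reg6 := (hk.1 _ (by norm_num)).trans h.reg6
  reg7 := (hk.1 _ (by norm_num)).trans h.reg7
  reg19 := (hk.1 _ (by norm_num)).trans h.reg19
  reg30 := (hk.1 _ (by norm_num)).trans h.reg30
  hm := h.hm
  hB := h.hB
  bdd := hb
  mem a ha := (hk.2 _ (by omega)).trans (h.mem a ha)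
  memU e he := (hk.2 _ (by have := h.hm; omega)).trans (h.memU e he)
  memV e he := (hk.2 _ (by have := h.hm; omega)).trans (h.memV e he)
  memA e he := (hk.2 _ (by have := h.hm; omega)).trans (h.memA e he)
  edge := h.edge
  mono := h.mono
  all := h.all

/-- The bound on all values that the machine handles, as a polynomial in the number of
vertices. -/
noncomputable def valueBound : Polynomial ℕ := 5 * (.X * .X) + .X + 5

/-- The polynomial factor of the running time. -/
noncomputable def timeBound : Polynomial ℕ :=
  (21 * valueBound + 60) * (.C (moveCost + 2) * (valueBound + 1) ^ 3) +
    .C (buildCost + connCost) * (valueBound + 1) ^ 3 + 50 * (valueBound + 1)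

theorem eval_valueBound (n : ℕ) : valueBound.eval n = 5 * (n * n) + n + 5 := by
  simp [valueBound]

theorem eval_timeBound (n : ℕ) : timeBound.eval n =
    (21 * valueBound.eval n + 60) * ((moveCost + 2) * (valueBound.eval n + 1) ^ 3) +
      (buildCost + connCost) * (valueBound.eval n + 1) ^ 3 + 50 * (valueBound.eval n + 1) := by
  simp [timeBound]

/-- For k > n even handling k takes time that depends on k, which no polynomial in n covers; this
lets the exponential factor absorb it. -/
theorem one_add_le_pow (k : ℕ) : (1 : ℝ) + k ≤ 3.4854 ^ k := by
  have h := one_add_mul_le_pow (show (-2 : ℝ) ≤ 2.4854 by norm_num) k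
  norm_num at h ⊢
  have : (0 : ℝ) ≤ k := Nat.cast_nonneg k
  linarith

theorem not_hasInternalSpanningTree (h : n < k ∨ n = 0) : ¬ G.HasInternalSpanningTree k := by
  rintro ⟨T, hT, hk⟩
  rcases h with h | rfl
  · have h1 := hk.trans (Set.encard_le_encard (Set.subset_univ _))
    rw [Set.encard_univ, ENat.card_eq_coe_fintype_card, Fintype.card_fin] at h1
    exact absurd (by exact_mod_cast h1) (not_le.2 h)
  · exact hT.2.connected.nonempty.elim fun x => x.elim0

theorem runs_algorithm_of_lt (h : n < k ∨ n = 0) (hb : (input G k).Bdd B) :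
    Runs algorithm (input G k) (50 * (B + 1)) (Answer (G.HasInternalSpanningTree k)) := by
  have hno := not_hasInternalSpanningTree (G := G) h
  refine Runs.cond_sub hb (by omega) (fun h0 => ?_) (fun h0 => ?_)
  · have hkn : k - n ≠ 0 := by
      have : n ≠ 0 := h0
      omega
    have hkB : k ≤ B := hb.1 1
    refine Runs.seq_eval (by trivial) hb (by simp only [Cmd.cost]; omega) ?_
    have hb' : ((input G k).setReg 2 (k - n)).Bdd B := hb.setReg (by omega)
    refine Runs.cond_sub hb' (by simp only [Cmd.cost]; omega) (fun _ => ?_) (fun h2 => ?_)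
    · refine (Runs.of_eval (by trivial) hb' ?_).mono (t := (Cmd.const 0 0).cost * (B + 1) ^ 1)
        (by simp only [Cmd.cost, pow_one]; omega) fun _ => id
      exact ⟨fun h => absurd h hno, fun _ => by simp [Cmd.eval]⟩
    · have h2' : k - n = 0 := h2
      exact absurd h2' hkn
  -- For n = 0 register 0 already holds the correct answer 0.
  · refine (Runs.of_eval (by trivial) hb ?_).mono (t := Cmd.skip.cost * (B + 1) ^ 1)
      (by simp only [Cmd.cost, pow_one]; omega) fun _ => id
    exact ⟨fun h => absurd h hno, fun _ => h0⟩

theorem runs_algorithm_of_le [NeZero n] (hG : G.IsSubcubic) (hk : k ≤ n)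
    (hB : 5 * (n * n) + n + 5 ≤ B) :
    Runs algorithm (input G k) (50 * (B + 1) + (buildCost * (B + 1) ^ 2 +
      (connCost * (B + 1) ^ 3 +
        ⌊(3.4854 : ℝ) ^ k * (((21 * B + 60) * ((moveCost + 2) * (B + 1) ^ 3) : ℕ) : ℝ)⌋₊)))
      (Answer (G.HasInternalSpanningTree k)) := by
  have hb : (input G k).Bdd B := input_bdd (by omega) (by omega) (by omega)
  refine Runs.cond_sub hb (by omega) (fun _ => ?_)
    (fun h0 => absurd (show n = 0 from h0) (NeZero.ne n))
  refine Runs.seq_eval (by trivial) hb (by simp only [Cmd.cost]; omega) ?_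
  have hb' : ((input G k).setReg 2 (k - n)).Bdd B := hb.setReg (by omega)
  refine Runs.cond_sub hb' (by simp only [Cmd.cost]; omega) (fun h2 => ?_) (fun _ => ?_)
  · have h2' : k - n ≠ 0 := h2
    omega
  refine Runs.seq_eval (by trivial) hb' (by simp only [Cmd.cost]; omega) ?_
  have hstart : (Cmd.const 2 1).eval ((input G k).setReg 2 (k - n)) = start G k := by
    simp [Cmd.eval, start, State.setReg]
  have hrun : Runs (build ⨾ conn ⨾ decideTree) (start G k) (buildCost * (B + 1) ^ 2 +
      (connCost * (B + 1) ^ 3 +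
        ⌊(3.4854 : ℝ) ^ k * (((21 * B + 60) * ((moveCost + 2) * (B + 1) ^ 3) : ℕ) : ℝ)⌋₊))
      (Answer (G.HasInternalSpanningTree k)) := by
    refine (runs_build (NeZero.ne n) hk hB).seq ?_
    rintro s ⟨m, u, v, h⟩
    refine (runs_conn h.env).seq ?_
    rintro s' ⟨hk', hb'', h15⟩
    rw [h.graph_eq] at h15
    exact runs_decideTree (h.of_keeps hk' hb'') hk hG h15
  rw [← hstart] at hrun
  refine hrun.mono ?_ fun _ => id
  simp only [Cmd.cost]
  omega

theorem answersInTime_algorithm (hG : G.IsSubcubic) :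
    AnswersInTime algorithm (input G k) (G.HasInternalSpanningTree k)
      (3.4854 ^ k * (timeBound.eval n : ℕ)) := by
  suffices ∃ T, Runs algorithm (input G k) T (Answer (G.HasInternalSpanningTree k)) ∧
      (T : ℝ) ≤ 3.4854 ^ k * (timeBound.eval n : ℕ) by
    obtain ⟨T, ⟨t, s', h1, h2, h3, h4⟩, h5⟩ := this
    exact ⟨t, s', h1, (Nat.cast_le.2 h2).trans h5, h3, h4⟩
  have hpow := one_add_le_pow k
  have hk0 : (0 : ℝ) ≤ k := Nat.cast_nonneg k
  have hpow1 : (1 : ℝ) ≤ 3.4854 ^ k := by linarith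
  obtain ⟨B, hB⟩ : ∃ B, valueBound.eval n = B := ⟨_, rfl⟩
  rw [eval_timeBound, hB]
  rw [eval_valueBound] at hB
  have hB0 : (0 : ℝ) ≤ B := Nat.cast_nonneg B
  by_cases hkn : n < k ∨ n = 0
  · refine ⟨_, runs_algorithm_of_lt hkn (B := B + k)
      (input_bdd (by omega) (by omega) (by omega)), ?_⟩
    push_cast
    calc (50 : ℝ) * (B + k + 1) ≤ (1 + k) * (50 * (B + 1)) := by nlinarith
      _ ≤ 3.4854 ^ k * (50 * (B + 1)) := mul_le_mul_of_nonneg_right hpow (by positivity)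
      _ ≤ _ := mul_le_mul_of_nonneg_left (le_add_of_nonneg_left (by positivity)) (by positivity)
  · have : NeZero n := ⟨fun h => hkn (.inr h)⟩
    refine ⟨_, runs_algorithm_of_le (B := B) hG (by omega) hB.le, ?_⟩
    have hfloor := Nat.floor_le (show (0 : ℝ) ≤ 3.4854 ^ k *
      (((21 * B + 60) * ((moveCost + 2) * (B + 1) ^ 3) : ℕ) : ℝ) by positivity)
    have h1 : 50 * (B + 1) + (buildCost * (B + 1) ^ 2 + connCost * (B + 1) ^ 3) ≤
        (buildCost + connCost) * (B + 1) ^ 3 + 50 * (B + 1) := by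
      have : buildCost * (B + 1) ^ 2 ≤ buildCost * (B + 1) ^ 3 :=
        Nat.mul_le_mul_left _ (Nat.pow_le_pow_right (Nat.succ_pos B) (by norm_num))
      rw [add_mul buildCost]
      omega
    generalize (21 * B + 60) * ((moveCost + 2) * (B + 1) ^ 3) = Y at hfloor ⊢
    generalize (buildCost + connCost) * (B + 1) ^ 3 = Z at h1 ⊢
    generalize buildCost * (B + 1) ^ 2 = b at h1 ⊢
    generalize connCost * (B + 1) ^ 3 = c at h1 ⊢
    generalize 50 * (B + 1) = a at h1 ⊢
    have h2 : ((a + (b + c) : ℕ) : ℝ) ≤ (Z + a : ℕ) := Nat.cast_le.2 h1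
    have h3 := le_mul_of_one_le_left (Nat.cast_nonneg (α := ℝ) (Z + a)) hpow1
    push_cast at h2 h3 ⊢
    linarith

end RAM

theorem mainTheorem6 :
    ∃ (P : RAM.Cmd) (p : Polynomial ℕ), ∀ (n k : ℕ) (G : SimpleGraph (Fin n)), G.IsSubcubic →
      RAM.AnswersInTime P (RAM.input G k) (G.HasInternalSpanningTree k)
        ((3.4854 : ℝ) ^ k * ((p.eval n : ℕ) : ℝ)) :=
  ⟨RAM.algorithm, RAM.timeBound, fun _ _ _ hG => RAM.answersInTime_algorithm hG⟩
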